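/- Let $\mathcal H$ be a separable complex Hilbert space, $\mathcal T(\mathcal H)$ its Banach space of trace-class operators with norm $\|A\|_{\mathrm{tr}}=\operatorname{tr}\big((A^*A)^{1/2}\big)$, and $\mathcal S(\mathcal H)=\{A\in\mathcal T(\mathcal H): A\ge 0,\ \operatorname{tr}A=1\}$. Let $(\mathcal X,\Sigma)$ be a measurable space, $D:\mathcal X\to\mathcal S(\mathcal H)$ a map that is measurable with respect to $\Sigma$ and the Borel $\sigma$-algebra of the trace norm (a classical-quantum channel), $P$ a probability measure on $(\mathcal X,\Sigma)$, and $X\sim P$. All expectations of operators are Bochner integrals in $\mathcal T(\mathcal H)$. Put $D_P:=\mathbb E\,D(X)$ and $$I(P,D):=\mathbb E\operatorname{tr}\big(D(X)\log D(X)\big)-\operatorname{tr}\big(D_P\log D_P\big),$$ with natural logarithm and $0\log 0=0$, and with the convention $I(P,D):=\infty$ if $D(X)\log D(X)\notin\mathcal T(\mathcal H)$ on a set of positive probability or $D_P\log D_P\notin\mathcal T(\mathcal H)$. For $n,M\ge 1$ let $\mathcal C=(\mathcal C(m))_{m=1}^M$ be a standard random codebook: the $\mathcal C(m)\in\mathcal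 X^n$ are independent, each with law $P^{\otimes n}$. Put $$D_{\mathcal C}:=\frac1M\sum_{m=1}^M D^n(\mathcal C(m)),\qquad D^n(x_1,\dots,x_n):=D(x_1)\otimes\cdots\otimes D(x_n)\ \text{ on } \mathcal H^{\otimes n}.$$ Let $R\in\mathbb R$ with $R>I(P,D)$, and assume that there is $\alpha_{\min}\in(0,1)$ such that $D_P^{\alpha_{\min}}\in\mathcal T(\mathcal H)$, $D(x)^{\alpha_{\min}}\in\mathcal T(\mathcal H)$ for $P$-almost all $x$, and the Bochner integral $\mathbb E\big(D(X)^{\alpha_{\min}}\big)\in\mathcal T(\mathcal H)$ exists. Then there is $\gamma\in(0,\infty)$ such that for all sufficiently large $n$ and every integer $M\ge\exp(nR)$, $$\mathbb E_{\mathcal C}\big\|D_{\mathcal C}-D_P^{\otimes n}\big\|_{\mathrm{tr}}\le\exp(-\gamma n).$$ -/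

import Mathlib

open MeasureTheory
open scoped ENNReal

namespace CQ

section TraceClass

variable {H : Type*} [NormedAddCommGroup H] [InnerProductSpace ℂ H]

theorem enorm_sq_eq_tsum {ι : Type*} (e : HilbertBasis ι ℂ H) (x : H) :
    ‖x‖ₑ ^ 2 = ∑' i, ‖inner ℂ (e i) x‖ₑ ^ 2 := by
  have h := e.hasSum_inner_mul_inner x x
  have h2 : HasSum (fun i => ‖inner ℂ (e i) x‖ ^ 2) (‖x‖ ^ 2) := by
    have h3 := Complex.hasSum_re h
    have e1 : (inner ℂ x x : ℂ).re = ‖x‖ ^ 2 := (inner_self_eq_norm_sq (𝕜 := ℂ) x)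
    rw [e1] at h3
    convert h3 using 2 with i
    rw [← inner_conj_symm x (e i), ← Complex.normSq_eq_conj_mul_self, Complex.ofReal_re,
      Complex.normSq_eq_norm_sq]
  have h4 := ENNReal.ofReal_tsum_of_nonneg (fun i => sq_nonneg ‖inner ℂ (e i) x‖) h2.summable
  rw [h2.tsum_eq] at h4
  simpa [ENNReal.ofReal_pow] using h4

variable [CompleteSpace H]

variable (H) in
/-- The index set of a fixed orthonormal basis of `H`. -/
def BasisIndex : Set H := (exists_hilbertBasis ℂ H).choose

variable (H) in
/-- A fixed orthonormal basis of `H`, used to write down traces. -/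
noncomputable def onb : HilbertBasis (BasisIndex H) ℂ H :=
  (exists_hilbertBasis ℂ H).choose_spec.choose

/-- The trace norm `tr |A|`, with `|A| = (A* A)^{1/2}`; it is `∞` if `A` is not trace class.
The choice of the basis is immaterial, see `traceNorm_eq`. -/
noncomputable def traceNorm (A : H →L[ℂ] H) : ℝ≥0∞ :=
  ∑' i, ENNReal.ofReal (inner ℂ (onb H i) (CFC.abs A (onb H i))).re

/-- `A` is trace class if `tr |A| < ∞`. -/
def IsTraceClass (A : H →L[ℂ] H) : Prop := traceNorm A < ∞

/-- The trace `∑ᵢ ⟪eᵢ, A eᵢ⟫` of a trace class operator. -/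
noncomputable def trace (A : H →L[ℂ] H) : ℂ := ∑' i, inner ℂ (onb H i) (A (onb H i))

theorem hilbertSchmidt_adjoint {ι κ : Type*} (e : HilbertBasis ι ℂ H) (f : HilbertBasis κ ℂ H)
    (T : H →L[ℂ] H) : ∑' i, ‖T (e i)‖ₑ ^ 2 = ∑' j, ‖star T (f j)‖ₑ ^ 2 := by
  simp_rw [enorm_sq_eq_tsum f (T _), enorm_sq_eq_tsum e (star T _)]
  rw [ENNReal.tsum_comm]
  refine tsum_congr fun j => tsum_congr fun i => ?_
  rw [ContinuousLinearMap.star_eq_adjoint, ContinuousLinearMap.adjoint_inner_right,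
    ← ofReal_norm, ← ofReal_norm, norm_inner_symm]

theorem ofReal_inner_abs (A : H →L[ℂ] H) (x : H) :
    ENNReal.ofReal (inner ℂ x (CFC.abs A x)).re = ‖CFC.sqrt (CFC.abs A) x‖ₑ ^ 2 := by
  have hs : star (CFC.sqrt (CFC.abs A)) = CFC.sqrt (CFC.abs A) :=
    (CFC.sqrt_nonneg (CFC.abs A)).isSelfAdjoint
  have h : CFC.abs A = star (CFC.sqrt (CFC.abs A)) * CFC.sqrt (CFC.abs A) := by
    rw [hs, CFC.sqrt_mul_sqrt_self _ (CFC.abs_nonneg A)]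
  conv_lhs => rw [h]
  rw [mul_apply_eq_comp, ContinuousLinearMap.star_eq_adjoint,
    ContinuousLinearMap.adjoint_inner_right]
  have e1 := inner_self_eq_norm_sq (𝕜 := ℂ) (CFC.sqrt (CFC.abs A) x)
  rw [← ofReal_norm, ← ENNReal.ofReal_pow (norm_nonneg _)]
  exact congrArg _ e1

/-- The trace norm does not depend on the orthonormal basis. -/
theorem traceNorm_eq {ι : Type*} (e : HilbertBasis ι ℂ H) (A : H →L[ℂ] H) :
    traceNorm A = ∑' i, ENNReal.ofReal (inner ℂ (e i) (CFC.abs A (e i))).re := by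
  have hs : star (CFC.sqrt (CFC.abs A)) = CFC.sqrt (CFC.abs A) :=
    (CFC.sqrt_nonneg (CFC.abs A)).isSelfAdjoint
  simp_rw [traceNorm, ofReal_inner_abs]
  rw [hilbertSchmidt_adjoint (onb H) e, hs]

/-- If `‖S x‖ ≤ ‖T x‖` for all `x`, then `S = W T` for a contraction `W`. -/
theorem exists_contraction (S T : H →L[ℂ] H) (h : ∀ x, ‖S x‖ ≤ ‖T x‖) :
    ∃ W : H →L[ℂ] H, (∀ x, ‖W x‖ ≤ ‖x‖) ∧ S = W * T := by
  set K : Submodule ℂ H := (LinearMap.range (T : H →ₗ[ℂ] H)).topologicalClosure with hK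
  have hKc : IsClosed (K : Set H) := Submodule.isClosed_topologicalClosure _
  have : CompleteSpace K := hKc.completeSpace_coe
  have hmem : ∀ x, (T : H →ₗ[ℂ] H) x ∈ K := fun x =>
    Submodule.le_topologicalClosure _ (LinearMap.mem_range_self _ x)
  let e : H →ₗ[ℂ] K := (T : H →ₗ[ℂ] H).codRestrict K hmem
  have hd : DenseRange e := by
    intro y
    rw [closure_subtype]
    have hy : (y : H) ∈ closure ((LinearMap.range (T : H →ₗ[ℂ] H) : Submodule ℂ H) : Set H) := y.2
    refine closure_mono ?_ hy
    rintro _ ⟨x, rfl⟩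
    exact ⟨e x, ⟨x, rfl⟩, rfl⟩
  have hn : ∀ x, ‖(S : H →ₗ[ℂ] H) x‖ ≤ 1 * ‖e x‖ := fun x => by
    rw [one_mul]; exact h x
  refine ⟨((S : H →ₗ[ℂ] H).extendOfNorm e).comp K.orthogonalProjectionOnto, fun x => ?_, ?_⟩
  · refine (LinearMap.norm_extendOfNorm_apply_le hd 1 hn _).trans ?_
    rw [one_mul]
    exact K.norm_orthogonalProjectionOnto_apply_le x
  · ext x
    have h1 : K.orthogonalProjectionOnto (T x) = e x :=
      K.orthogonalProjectionOnto_mem_subspace_eq_self (e x)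
    have h2 := LinearMap.extendOfNorm_eq hd ⟨1, hn⟩ x
    change S x = (S : H →ₗ[ℂ] H).extendOfNorm e (K.orthogonalProjectionOnto (T x))
    rw [h1, h2]
    rfl

theorem norm_abs_apply (A : H →L[ℂ] H) (x : H) : ‖CFC.abs A x‖ = ‖A x‖ := by
  have hs : star (CFC.abs A) = CFC.abs A := (CFC.abs_nonneg A).isSelfAdjoint
  have h : star (CFC.abs A) * CFC.abs A = star A * A := by rw [hs, CFC.abs_mul_abs]
  have e : ∀ B : H →L[ℂ] H, inner ℂ x ((star B * B) x) = ((‖B x‖ ^ 2 : ℝ) : ℂ) := by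
    intro B
    rw [mul_apply_eq_comp, ContinuousLinearMap.star_eq_adjoint,
      ContinuousLinearMap.adjoint_inner_right, inner_self_eq_norm_sq_to_K]
    simp
  have h2 := e (CFC.abs A)
  rw [h, e A] at h2
  have h3 : ‖A x‖ ^ 2 = ‖CFC.abs A x‖ ^ 2 := by exact_mod_cast h2
  exact ((sq_eq_sq₀ (norm_nonneg _) (norm_nonneg _)).1 h3).symm

/-- `∑ᵢ |⟪eᵢ, W A eᵢ⟫| ≤ tr |A|` for every contraction `W`. -/
theorem tsum_enorm_inner_le (W A : H →L[ℂ] H) (hW : ∀ x, ‖W x‖ ≤ ‖x‖) :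
    ∑' i, ‖inner ℂ (onb H i) ((W * A) (onb H i))‖ₑ ≤ traceNorm A := by
  obtain ⟨V, hV, hA⟩ := exists_contraction A (CFC.abs A) (fun x => (norm_abs_apply A x).ge)
  set Q := CFC.sqrt (CFC.abs A) with hQ
  have hs : star Q = Q := (CFC.sqrt_nonneg (CFC.abs A)).isSelfAdjoint
  have hQQ : CFC.abs A = Q * Q := (CFC.sqrt_mul_sqrt_self _ (CFC.abs_nonneg A)).symm
  set T := W * V * Q with hT
  have hWA : W * A = T * Q := by rw [hA, hQQ, hT]; simp only [mul_assoc]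
  have htr : traceNorm A = ∑' i, ‖Q (onb H i)‖ₑ ^ 2 := by
    simp_rw [traceNorm, ofReal_inner_abs]; rfl
  have hTs : ∑' i, ‖star T (onb H i)‖ₑ ^ 2 ≤ traceNorm A := by
    rw [← hilbertSchmidt_adjoint (onb H), htr]
    refine ENNReal.tsum_le_tsum fun i => ?_
    gcongr
    rw [← ofReal_norm, ← ofReal_norm]
    exact ENNReal.ofReal_le_ofReal ((hW _).trans (hV _))
  have hi : ∀ i, ‖inner ℂ (onb H i) ((W * A) (onb H i))‖ₑ
      ≤ 2⁻¹ * (‖star T (onb H i)‖ₑ ^ 2 + ‖Q (onb H i)‖ₑ ^ 2) := by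
    intro i
    rw [hWA, mul_apply_eq_comp, ← ContinuousLinearMap.adjoint_inner_left,
      ← ContinuousLinearMap.star_eq_adjoint]
    have h1 := norm_inner_le_norm (𝕜 := ℂ) (star T (onb H i)) (Q (onb H i))
    have h2 : ‖inner ℂ (star T (onb H i)) (Q (onb H i))‖
        ≤ 2⁻¹ * (‖star T (onb H i)‖ ^ 2 + ‖Q (onb H i)‖ ^ 2) := by
      nlinarith [sq_nonneg (‖star T (onb H i)‖ - ‖Q (onb H i)‖)]
    have h3 := ENNReal.ofReal_le_ofReal h2
    rw [ENNReal.ofReal_mul (by norm_num), ENNReal.ofReal_add (by positivity) (by positivity),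
      ENNReal.ofReal_pow (norm_nonneg _), ENNReal.ofReal_pow (norm_nonneg _),
      ENNReal.ofReal_inv_of_pos (by norm_num)] at h3
    simpa using h3
  calc _ ≤ ∑' i, 2⁻¹ * (‖star T (onb H i)‖ₑ ^ 2 + ‖Q (onb H i)‖ₑ ^ 2) := ENNReal.tsum_le_tsum hi
    _ = 2⁻¹ * (∑' i, ‖star T (onb H i)‖ₑ ^ 2 + traceNorm A) := by
      rw [ENNReal.tsum_mul_left, ENNReal.tsum_add, htr]
    _ ≤ 2⁻¹ * (traceNorm A + traceNorm A) := by gcongr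
    _ = traceNorm A := by
      rw [← two_mul, ← mul_assoc, ENNReal.inv_mul_cancel (by norm_num) (by norm_num), one_mul]

theorem traceNorm_add_le (A B : H →L[ℂ] H) : traceNorm (A + B) ≤ traceNorm A + traceNorm B := by
  obtain ⟨W, hW, hAB⟩ := exists_contraction (CFC.abs (A + B)) (A + B)
    (fun x => (norm_abs_apply (A + B) x).le)
  calc traceNorm (A + B)
      ≤ ∑' i, (‖inner ℂ (onb H i) ((W * A) (onb H i))‖ₑ
          + ‖inner ℂ (onb H i) ((W * B) (onb H i))‖ₑ) := by
        refine ENNReal.tsum_le_tsum fun i => ?_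
        rw [hAB, mul_add, add_apply, inner_add_right]
        refine (ENNReal.ofReal_le_ofReal (Complex.re_le_norm _)).trans ?_
        rw [ofReal_norm]
        exact enorm_add_le _ _
    _ ≤ traceNorm A + traceNorm B := by
        rw [ENNReal.tsum_add]
        exact add_le_add (tsum_enorm_inner_le W A hW) (tsum_enorm_inner_le W B hW)

theorem traceNorm_smul (c : ℂ) (A : H →L[ℂ] H) : traceNorm (c • A) = ‖c‖ₑ * traceNorm A := by
  rw [traceNorm, traceNorm, ← ENNReal.tsum_mul_left]
  refine tsum_congr fun i => ?_
  rw [CFC.abs_smul, ← ofReal_norm, ← ENNReal.ofReal_mul (norm_nonneg _)]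
  simp

theorem traceNorm_zero : traceNorm (0 : H →L[ℂ] H) = 0 := by
  simpa using traceNorm_smul (0 : ℂ) (0 : H →L[ℂ] H)

theorem opNorm_le_traceNorm (A : H →L[ℂ] H) : ‖A‖ₑ ≤ traceNorm A := by
  by_cases hfin : traceNorm A = ∞
  · simp [hfin]
  set Q := CFC.sqrt (CFC.abs A) with hQ
  have hs : star Q = Q := (CFC.sqrt_nonneg (CFC.abs A)).isSelfAdjoint
  have hQQ : CFC.abs A = star Q * Q := by
    rw [hs]; exact (CFC.sqrt_mul_sqrt_self _ (CFC.abs_nonneg A)).symm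
  have hA : ‖A‖ = ‖Q‖ ^ 2 := by
    rw [← CFC.norm_abs, hQQ, CStarRing.norm_star_mul_self, sq]
  have htr : traceNorm A = ∑' i, ‖Q (onb H i)‖ₑ ^ 2 := by
    simp_rw [traceNorm, ofReal_inner_abs]; rfl
  have hx : ∀ x, ‖Q x‖ₑ ^ 2 ≤ traceNorm A * ‖x‖ₑ ^ 2 := by
    intro x
    rw [enorm_sq_eq_tsum (onb H), htr, ← ENNReal.tsum_mul_right]
    refine ENNReal.tsum_le_tsum fun i => ?_
    rw [← mul_pow]
    gcongr
    have h1 := norm_inner_le_norm (𝕜 := ℂ) (Q (onb H i)) x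
    rw [← hs, ContinuousLinearMap.star_eq_adjoint, ContinuousLinearMap.adjoint_inner_right,
      ← ofReal_norm, ← ofReal_norm, ← ofReal_norm, ← ENNReal.ofReal_mul (norm_nonneg _),
      ← ContinuousLinearMap.star_eq_adjoint, hs]
    exact ENNReal.ofReal_le_ofReal h1
  have hb : ‖Q‖ ≤ √(traceNorm A).toReal := by
    refine Q.opNorm_le_bound (Real.sqrt_nonneg _) fun x => ?_
    refine le_of_sq_le_sq ?_ (by positivity)
    rw [mul_pow, Real.sq_sqrt ENNReal.toReal_nonneg]
    have := ENNReal.toReal_mono (ENNReal.mul_ne_top hfin (by simp)) (hx x)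
    simpa using this
  rw [← ofReal_norm, hA]
  refine ENNReal.ofReal_le_of_le_toReal ?_
  calc ‖Q‖ ^ 2 ≤ √(traceNorm A).toReal ^ 2 := by gcongr
    _ = _ := Real.sq_sqrt ENNReal.toReal_nonneg

variable (H) in
/-- The trace class operators, as a subspace of the bounded operators. -/
noncomputable def traceClassSubmodule : Submodule ℂ (H →L[ℂ] H) where
  carrier := {A | IsTraceClass A}
  zero_mem' := by simp [IsTraceClass, traceNorm_zero]
  add_mem' {A B} hA hB := (traceNorm_add_le A B).trans_lt (ENNReal.add_lt_top.2 ⟨hA, hB⟩)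
  smul_mem' c A hA := by
    simp only [Set.mem_ofPred_eq, IsTraceClass, traceNorm_smul]
    exact ENNReal.mul_lt_top (by simp) hA

variable (H) in
/-- The space of trace class operators; it carries the trace norm (not the operator norm). -/
def TraceClass : Type _ := traceClassSubmodule H

namespace TraceClass

noncomputable instance : AddCommGroup (TraceClass H) :=
  inferInstanceAs (AddCommGroup (traceClassSubmodule H))

noncomputable instance : Module ℂ (TraceClass H) :=
  inferInstanceAs (Module ℂ (traceClassSubmodule H))

/-- The underlying bounded operator. -/
def op (A : TraceClass H) : H →L[ℂ] H := A.1

/-- A bounded operator with finite trace norm, as an element of the trace class. -/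
def mk (A : H →L[ℂ] H) (h : IsTraceClass A) : TraceClass H := ⟨A, h⟩

theorem isTraceClass (A : TraceClass H) : IsTraceClass A.op := A.2

theorem ext {A B : TraceClass H} (h : A.op = B.op) : A = B := Subtype.ext h

noncomputable instance : Norm (TraceClass H) := ⟨fun A => (traceNorm A.op).toReal⟩

theorem norm_def (A : TraceClass H) : ‖A‖ = (traceNorm A.op).toReal := rfl

theorem normedSpaceCore : NormedSpace.Core ℂ (TraceClass H) where
  norm_nonneg _ := ENNReal.toReal_nonneg
  norm_smul c A := by
    change (traceNorm (c • A.op)).toReal = _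
    rw [traceNorm_smul, ENNReal.toReal_mul, norm_def]
    simp
  norm_triangle A B := by
    change (traceNorm (A.op + B.op)).toReal ≤ _
    rw [norm_def, norm_def, ← ENNReal.toReal_add A.isTraceClass.ne B.isTraceClass.ne]
    exact ENNReal.toReal_mono (ENNReal.add_lt_top.2 ⟨A.isTraceClass, B.isTraceClass⟩).ne
      (traceNorm_add_le _ _)
  norm_eq_zero_iff A := by
    constructor
    · intro h
      rw [norm_def, ENNReal.toReal_eq_zero_iff] at h
      have h0 := h.resolve_right A.isTraceClass.ne
      have h1 := (opNorm_le_traceNorm A.op).trans_eq h0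
      exact ext (enorm_eq_zero.1 (le_antisymm h1 zero_le))
    · rintro rfl
      change (traceNorm (0 : H →L[ℂ] H)).toReal = 0
      simp [traceNorm_zero]

noncomputable instance : NormedAddCommGroup (TraceClass H) :=
  NormedAddCommGroup.ofCore (normedSpaceCore (H := H))

noncomputable instance : NormedSpace ℂ (TraceClass H) := NormedSpace.ofCore (normedSpaceCore (H := H))

noncomputable instance : NormedSpace ℝ (TraceClass H) := NormedSpace.restrictScalars ℝ ℂ _

noncomputable instance : MeasurableSpace (TraceClass H) := borel _

instance : BorelSpace (TraceClass H) := ⟨rfl⟩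

theorem opNorm_le_norm (A : TraceClass H) : ‖A.op‖ ≤ ‖A‖ := by
  have h := ENNReal.toReal_mono A.isTraceClass.ne (opNorm_le_traceNorm A.op)
  simpa [norm_def] using h

/-- Trace norm balls are closed in the operator norm. -/
theorem _root_.CQ.traceNorm_le_of_tendsto {u : ℕ → H →L[ℂ] H} {A : H →L[ℂ] H} {r : ℝ≥0∞}
    (hu : Filter.Tendsto u Filter.atTop (nhds A)) (hr : ∀ᶠ n in Filter.atTop, traceNorm (u n) ≤ r) :
    traceNorm A ≤ r := by
  rw [traceNorm, ENNReal.tsum_eq_iSup_sum]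
  refine iSup_le fun s => ?_
  have hc : Continuous fun B : H →L[ℂ] H =>
      ∑ i ∈ s, ENNReal.ofReal (inner ℂ (onb H i) (CFC.abs B (onb H i))).re := by
    refine continuous_finsetSum _ fun i _ => ENNReal.continuous_ofReal.comp ?_
    refine Complex.continuous_re.comp (continuous_const.inner ?_)
    exact (ContinuousLinearMap.apply ℂ H ((onb H i : H))).continuous.comp CFC.continuous_abs
  refine le_of_tendsto ((hc.tendsto A).comp hu) ?_
  filter_upwards [hr] with n hn
  exact (ENNReal.sum_le_tsum s).trans hn

instance : CompleteSpace (TraceClass H) := by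
  refine Metric.complete_of_cauchySeq_tendsto fun u hu => ?_
  have hop : CauchySeq fun n => (u n).op := by
    rw [Metric.cauchySeq_iff] at hu ⊢
    intro ε hε
    obtain ⟨N, hN⟩ := hu ε hε
    refine ⟨N, fun m hm n hn => ?_⟩
    have h := hN m hm n hn
    rw [dist_eq_norm] at h ⊢
    exact (opNorm_le_norm (u m - u n)).trans_lt h
  obtain ⟨A, hA⟩ := cauchySeq_tendsto_of_complete hop
  have key : ∀ ε > 0, ∃ N, ∀ n ≥ N, traceNorm ((u n).op - A) ≤ ENNReal.ofReal ε := by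
    intro ε hε
    obtain ⟨N, hN⟩ := Metric.cauchySeq_iff.1 hu ε hε
    refine ⟨N, fun n hn => ?_⟩
    refine traceNorm_le_of_tendsto (u := fun m => (u n).op - (u m).op) (hA.const_sub _) ?_
    filter_upwards [Filter.eventually_ge_atTop N] with m hm
    have h := hN n hn m hm
    rw [dist_eq_norm, norm_def] at h
    exact (ENNReal.le_ofReal_iff_toReal_le (u n - u m).isTraceClass.ne hε.le).2 h.le
  obtain ⟨N, hN⟩ := key 1 one_pos
  have hAt : IsTraceClass A := by
    have h : A = (u N).op + (-1 : ℂ) • ((u N).op - A) := by simp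
    rw [h]
    refine (traceNorm_add_le _ _).trans_lt (ENNReal.add_lt_top.2 ⟨(u N).isTraceClass, ?_⟩)
    rw [traceNorm_smul]
    exact ENNReal.mul_lt_top (by simp) ((hN N le_rfl).trans_lt ENNReal.ofReal_lt_top)
  refine ⟨mk A hAt, ?_⟩
  rw [Metric.tendsto_atTop]
  intro ε hε
  obtain ⟨N, hN⟩ := key (ε / 2) (half_pos hε)
  refine ⟨N, fun n hn => ?_⟩
  rw [dist_eq_norm]
  have h := ENNReal.toReal_mono ENNReal.ofReal_ne_top (hN n hn)
  rw [ENNReal.toReal_ofReal (half_pos hε).le] at h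
  exact lt_of_le_of_lt h (half_lt_self hε)

end TraceClass

end TraceClass
section Tensor

/-- The algebraic `n`-fold tensor power of `H`. -/
def AlgTensorPower (n : ℕ) (H : Type*) [NormedAddCommGroup H] [InnerProductSpace ℂ H] : Type _ :=
  PiTensorProduct ℂ (fun _ : Fin n => H)

variable (n : ℕ) (H : Type*) [NormedAddCommGroup H] [InnerProductSpace ℂ H]

noncomputable instance : AddCommGroup (AlgTensorPower n H) :=
  inferInstanceAs (AddCommGroup (PiTensorProduct ℂ (fun _ : Fin n => H)))

noncomputable instance : Module ℂ (AlgTensorPower n H) :=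
  inferInstanceAs (Module ℂ (PiTensorProduct ℂ (fun _ : Fin n => H)))

variable {H}

/-- The elementary tensor `x₁ ⊗ ⋯ ⊗ xₙ`, as a multilinear map. -/
noncomputable def AlgTensorPower.tprod : MultilinearMap ℂ (fun _ : Fin n => H) (AlgTensorPower n H) :=
  PiTensorProduct.tprod ℂ

variable {n}

theorem AlgTensorPower.induction {motive : AlgTensorPower n H → Prop} (t : AlgTensorPower n H)
    (smul : ∀ (r : ℂ) x, motive (r • AlgTensorPower.tprod n x))
    (add : ∀ s t, motive s → motive t → motive (s + t)) : motive t :=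
  PiTensorProduct.induction_on (motive := motive) t smul (fun {s t} hs ht => add s t hs ht)

/-- The linear functional `t ↦ ⟪x₁ ⊗ ⋯ ⊗ xₙ, t⟫`. -/
noncomputable def innerTprod (x : Fin n → H) : AlgTensorPower n H →ₗ[ℂ] ℂ :=
  PiTensorProduct.lift ((MultilinearMap.mkPiAlgebra ℂ (Fin n) ℂ).compLinearMap
    (fun k => ((innerSL ℂ (x k) : H →L[ℂ] ℂ) : H →ₗ[ℂ] ℂ)))

theorem innerTprod_tprod (x y : Fin n → H) :
    innerTprod x (AlgTensorPower.tprod n y) = ∏ k, inner ℂ (x k) (y k) := by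
  refine (PiTensorProduct.lift.tprod y).trans ?_
  simp

theorem innerTprod_update_add (x : Fin n → H) (k : Fin n) (u v : H) (t : AlgTensorPower n H) :
    innerTprod (Function.update x k (u + v)) t
      = innerTprod (Function.update x k u) t + innerTprod (Function.update x k v) t := by
  induction t using AlgTensorPower.induction with
  | smul r y =>
    simp only [map_smul, innerTprod_tprod, ← smul_add]
    congr 1
    have h : ∀ w : H, ∏ j, inner ℂ (Function.update x k w j) (y j)
        = inner ℂ w (y k) * ∏ j ∈ Finset.univ.erase k, inner ℂ (x j) (y j) := by
      intro w
      rw [← Finset.mul_prod_erase Finset.univ _ (Finset.mem_univ k)]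
      congr 1
      · simp
      · exact Finset.prod_congr rfl fun j hj => by
          rw [Function.update_of_ne (Finset.ne_of_mem_erase hj)]
    rw [h, h, h, inner_add_left, add_mul]
  | add s t hs ht => rw [map_add, map_add, map_add, hs, ht]; ring

theorem innerTprod_update_smul (x : Fin n → H) (k : Fin n) (c : ℂ) (u : H)
    (t : AlgTensorPower n H) :
    innerTprod (Function.update x k (c • u)) t
      = (starRingEnd ℂ) c * innerTprod (Function.update x k u) t := by
  induction t using AlgTensorPower.induction with
  | smul r y =>
    simp only [map_smul, innerTprod_tprod, smul_eq_mul]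
    have h : ∀ w : H, ∏ j, inner ℂ (Function.update x k w j) (y j)
        = inner ℂ w (y k) * ∏ j ∈ Finset.univ.erase k, inner ℂ (x j) (y j) := by
      intro w
      rw [← Finset.mul_prod_erase Finset.univ _ (Finset.mem_univ k)]
      congr 1
      · simp
      · exact Finset.prod_congr rfl fun j hj => by
          rw [Function.update_of_ne (Finset.ne_of_mem_erase hj)]
    rw [h, h, inner_smul_left]; ring
  | add s t hs ht => rw [map_add, map_add, hs, ht]; ring

/-- The linear functional `s ↦ conj ⟪s, t⟫`. -/
noncomputable def conjInner (t : AlgTensorPower n H) : AlgTensorPower n H →ₗ[ℂ] ℂ :=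
  PiTensorProduct.lift (MultilinearMap.mk'
    (fun x : Fin n → H => (starRingEnd ℂ) (innerTprod x t))
    (fun x k u v => by simp [innerTprod_update_add])
    (fun x k c u => by simp [innerTprod_update_smul]))

theorem conjInner_tprod (t : AlgTensorPower n H) (x : Fin n → H) :
    conjInner t (AlgTensorPower.tprod n x) = (starRingEnd ℂ) (innerTprod x t) := by
  exact (PiTensorProduct.lift.tprod x).trans rfl

/-- The inner product of the algebraic tensor power: the sesquilinear form determined by
`⟪x₁ ⊗ ⋯ ⊗ xₙ, y₁ ⊗ ⋯ ⊗ yₙ⟫ = ∏ₖ ⟪xₖ, yₖ⟫`. -/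
noncomputable def algInner (s t : AlgTensorPower n H) : ℂ := (starRingEnd ℂ) (conjInner t s)

theorem algInner_tprod (x y : Fin n → H) :
    algInner (AlgTensorPower.tprod n x) (AlgTensorPower.tprod n y)
      = ∏ k, inner ℂ (x k) (y k) := by
  simp only [algInner, conjInner_tprod, innerTprod_tprod, Complex.conj_conj]

theorem algInner_add_left (s s' t : AlgTensorPower n H) :
    algInner (s + s') t = algInner s t + algInner s' t := by simp [algInner]

theorem algInner_smul_left (r : ℂ) (s t : AlgTensorPower n H) :
    algInner (r • s) t = (starRingEnd ℂ) r * algInner s t := by simp [algInner]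

theorem algInner_add_right (s t t' : AlgTensorPower n H) :
    algInner s (t + t') = algInner s t + algInner s t' := by
  induction s using AlgTensorPower.induction with
  | smul r x => simp [algInner, conjInner_tprod, mul_add]
  | add s s' hs hs' => rw [algInner_add_left, hs, hs', algInner_add_left, algInner_add_left]; ring

theorem algInner_smul_right (r : ℂ) (s t : AlgTensorPower n H) :
    algInner s (r • t) = r * algInner s t := by
  induction s using AlgTensorPower.induction with
  | smul c x => simp [algInner, conjInner_tprod]; ring
  | add s s' hs hs' => rw [algInner_add_left, hs, hs', algInner_add_left]; ring

theorem algInner_conj_symm (s t : AlgTensorPower n H) :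
    (starRingEnd ℂ) (algInner t s) = algInner s t := by
  induction s using AlgTensorPower.induction with
  | smul r x =>
    induction t using AlgTensorPower.induction with
    | smul c y =>
      simp only [algInner_smul_left, algInner_smul_right, algInner_tprod, map_mul, map_prod,
        inner_conj_symm, Complex.conj_conj]
      ring
    | add t t' ht ht' => rw [algInner_add_left, algInner_add_right, map_add, ht, ht']
  | add s s' hs hs' => rw [algInner_add_left, algInner_add_right, map_add, hs, hs']

theorem algInner_sum_left {ι : Type*} (a : Finset ι) (f : ι → AlgTensorPower n H)
    (t : AlgTensorPower n H) : algInner (∑ i ∈ a, f i) t = ∑ i ∈ a, algInner (f i) t := by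
  simp [algInner]

theorem algInner_sum_right {ι : Type*} (a : Finset ι) (f : ι → AlgTensorPower n H)
    (s : AlgTensorPower n H) : algInner s (∑ i ∈ a, f i) = ∑ i ∈ a, algInner s (f i) := by
  rw [← algInner_conj_symm, algInner_sum_left, map_sum]
  simp [algInner_conj_symm]

open scoped ComplexOrder in
theorem posSemidef_prod_gram {ι : Type*} [Finite ι] (x : ι → Fin n → H) (a : Finset (Fin n)) :
    (Matrix.of fun i j => ∏ k ∈ a, inner ℂ (x i k) (x j k) : Matrix ι ι ℂ).PosSemidef := by
  classical
  induction a using Finset.induction_on with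
  | empty =>
    have e : (Matrix.of fun i j => ∏ k ∈ (∅ : Finset (Fin n)), inner ℂ (x i k) (x j k) :
        Matrix ι ι ℂ) = Matrix.gram ℂ (fun _ : ι => (1 : ℂ)) := by
      ext i j
      simp [Matrix.gram]
    rw [e]
    exact Matrix.posSemidef_gram ℂ _
  | insert k a hk ih =>
    have e : (Matrix.of fun i j => ∏ k ∈ insert k a, inner ℂ (x i k) (x j k) : Matrix ι ι ℂ)
        = (Matrix.gram ℂ (fun i : ι => x i k)).hadamard
          (Matrix.of fun i j => ∏ k ∈ a, inner ℂ (x i k) (x j k)) := by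
      ext i j
      simp [Matrix.gram, Finset.prod_insert hk]
    rw [e]
    exact (Matrix.posSemidef_gram ℂ _).hadamard ih

open scoped ComplexOrder in
theorem algInner_self_nonneg (t : AlgTensorPower n H) : 0 ≤ (algInner t t).re := by
  classical
  have ht : t ∈ Submodule.span ℂ (Set.range (AlgTensorPower.tprod n (H := H))) := by
    have := PiTensorProduct.span_tprod_eq_top (R := ℂ) (s := fun _ : Fin n => H)
    exact this.ge (Submodule.mem_top (x := t))
  obtain ⟨c, rfl⟩ := (Finsupp.mem_span_range_iff_exists_finsupp).1 ht
  have h := (posSemidef_prod_gram (fun i : c.support => (i : Fin n → H)) Finset.univ).dotProduct_mulVec_nonneg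
    (fun i : c.support => c i)
  have h2 := (Complex.nonneg_iff.1 h).1
  refine h2.trans_eq ?_
  congr 1
  simp only [Finsupp.sum, algInner_sum_left, algInner_sum_right, algInner_smul_left,
    algInner_smul_right, algInner_tprod]
  simp only [dotProduct, Matrix.mulVec, Matrix.of_apply, Finset.mul_sum, Pi.star_apply]
  rw [Finset.sum_comm, ← Finset.sum_attach c.support]
  refine Finset.sum_congr rfl fun i _ => ?_
  rw [← Finset.sum_attach c.support]
  refine Finset.sum_congr rfl fun j _ => ?_
  simp only [RCLike.star_def]
  ring

/-- The pre-inner product space structure of the algebraic tensor power. -/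
noncomputable abbrev algTensorCore : PreInnerProductSpace.Core ℂ (AlgTensorPower n H) where
  inner := algInner
  conj_inner_symm := algInner_conj_symm
  re_inner_nonneg := algInner_self_nonneg
  add_left := algInner_add_left
  smul_left s t r := algInner_smul_left r s t

noncomputable instance : SeminormedAddCommGroup (AlgTensorPower n H) :=
  InnerProductSpace.Core.toSeminormedAddCommGroup (c := algTensorCore)

noncomputable instance : InnerProductSpace ℂ (AlgTensorPower n H) :=
  InnerProductSpace.ofCore algTensorCore

variable (n H) in
/-- The Hilbert space `H^{⊗n}`: the completion of the algebraic tensor power. -/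
abbrev TensorPower : Type _ := UniformSpace.Completion (AlgTensorPower n H)

/-- The elementary tensor `x₁ ⊗ ⋯ ⊗ xₙ` in `H^{⊗n}`. -/
noncomputable def tmul (x : Fin n → H) : TensorPower n H :=
  ((AlgTensorPower.tprod n x : AlgTensorPower n H) : TensorPower n H)

theorem inner_tmul (x y : Fin n → H) :
    inner ℂ (tmul x) (tmul y) = ∏ k, inner ℂ (x k) (y k) := by
  rw [tmul, tmul, UniformSpace.Completion.inner_coe]
  exact algInner_tprod x y

/-- The algebraic tensor product `A₁ ⊗ ⋯ ⊗ Aₙ`. -/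
noncomputable def algMap (A : Fin n → H →L[ℂ] H) : AlgTensorPower n H →ₗ[ℂ] AlgTensorPower n H :=
  PiTensorProduct.map (fun k => (A k : H →ₗ[ℂ] H))

theorem algMap_tprod (A : Fin n → H →L[ℂ] H) (x : Fin n → H) :
    algMap A (AlgTensorPower.tprod n x) = AlgTensorPower.tprod n (fun k => A k (x k)) := by
  simp only [algMap, AlgTensorPower.tprod]
  exact PiTensorProduct.map_tprod _ _

theorem algMap_mul (A B : Fin n → H →L[ℂ] H) (t : AlgTensorPower n H) :
    algMap (A * B) t = algMap A (algMap B t) := by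
  induction t using AlgTensorPower.induction with
  | smul r x => simp [algMap_tprod]
  | add s t hs ht => simp [hs, ht]

theorem algMap_update_sub (A : Fin n → H →L[ℂ] H) (k : Fin n) (S T : H →L[ℂ] H)
    (t : AlgTensorPower n H) :
    algMap (Function.update A k (S - T)) t
      = algMap (Function.update A k S) t - algMap (Function.update A k T) t := by
  induction t using AlgTensorPower.induction with
  | smul r x =>
    have h : ∀ W : H →L[ℂ] H, (fun j => Function.update A k W j (x j))
        = Function.update (fun j => A j (x j)) k (W (x k)) := by
      intro W; funext j
      by_cases hj : j = k
      · subst hj; simp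
      · simp [hj]
    simp only [map_smul, algMap_tprod, h, sub_apply,
      MultilinearMap.map_update_sub, smul_sub]
  | add s t hs ht => simp only [map_add, hs, ht]; abel

theorem algMap_update_const (k : Fin n) (c : ℝ) (t : AlgTensorPower n H) :
    algMap (Function.update 1 k (algebraMap ℝ (H →L[ℂ] H) c)) t = (c : ℂ) • t := by
  induction t using AlgTensorPower.induction with
  | smul r x =>
    have h : (fun j => (Function.update (1 : Fin n → H →L[ℂ] H) k
        (algebraMap ℝ (H →L[ℂ] H) c)) j (x j)) = Function.update x k ((c : ℂ) • x k) := by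
      funext j
      by_cases hj : j = k
      · subst hj
        simp [Algebra.algebraMap_eq_smul_one]
      · simp [hj]
    rw [map_smul, algMap_tprod, h, MultilinearMap.map_update_smul, Function.update_eq_self,
      smul_comm]
  | add s t hs ht => rw [map_add, hs, ht, smul_add]

variable [CompleteSpace H]

theorem algInner_algMap (A B : Fin n → H →L[ℂ] H) (s t : AlgTensorPower n H) :
    algInner (algMap A s) (algMap B t) = algInner s (algMap (star A * B) t) := by
  induction s using AlgTensorPower.induction with
  | smul r x =>
    induction t using AlgTensorPower.induction with
    | smul c y =>
      simp only [map_smul, algMap_tprod, algInner_smul_left, algInner_smul_right, algInner_tprod]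
      congr 2
      refine Finset.prod_congr rfl fun k _ => ?_
      simp [ContinuousLinearMap.star_eq_adjoint, ContinuousLinearMap.adjoint_inner_right]
    | add t t' ht ht' => simp only [map_add, algInner_add_right, ht, ht']
  | add s s' hs hs' => simp only [map_add, algInner_add_left, hs, hs']

theorem norm_algMap_single (k : Fin n) (S : H →L[ℂ] H) (t : AlgTensorPower n H) :
    ‖algMap (Function.update 1 k S) t‖ ≤ ‖S‖ * ‖t‖ := by
  -- `‖S‖² - S* S = B* B`, hence `‖S‖² ‖t‖² - ‖S t‖² = ‖B t‖² ≥ 0` in the `k`-th slot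
  have hpos : (0 : H →L[ℂ] H) ≤ algebraMap ℝ (H →L[ℂ] H) (‖S‖ ^ 2) - star S * S := by
    rw [sub_nonneg, sq, ← CStarRing.norm_star_mul_self (x := S)]
    exact IsSelfAdjoint.le_algebraMap_norm_self
  obtain ⟨B, hB⟩ := CStarAlgebra.nonneg_iff_eq_star_mul_self.1 hpos
  have key : ∀ W : H →L[ℂ] H, algInner (algMap (Function.update 1 k W) t)
      (algMap (Function.update 1 k W) t)
        = algInner t (algMap (Function.update 1 k (star W * W)) t) := by
    intro W
    rw [algInner_algMap]
    congr 3
    funext j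
    by_cases hj : j = k
    · subst hj; simp
    · simp [hj]
  have hN : ∀ s : AlgTensorPower n H, ‖s‖ ^ 2 = (algInner s s).re := fun s =>
    InnerProductSpace.norm_sq_eq_re_inner (𝕜 := ℂ) s
  have hB2 := key B
  rw [← hB, algMap_update_sub, algMap_update_const, sub_eq_add_neg, algInner_add_right, ← neg_one_smul ℂ,
    algInner_smul_right, algInner_smul_right, ← key S] at hB2
  have h3 := congrArg Complex.re hB2
  have h4 : 0 ≤ (algInner (algMap (Function.update 1 k B) t)
      (algMap (Function.update 1 k B) t)).re := algInner_self_nonneg _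
  rw [h3, Complex.add_re, Complex.re_ofReal_mul, ← hN, neg_one_mul, Complex.neg_re, ← hN] at h4
  refine le_of_sq_le_sq ?_ (by positivity)
  nlinarith

theorem norm_algMap_le (A : Fin n → H →L[ℂ] H) (t : AlgTensorPower n H) :
    ‖algMap A t‖ ≤ (∏ k, ‖A k‖) * ‖t‖ := by
  classical
  have main : ∀ (a : Finset (Fin n)) (t : AlgTensorPower n H),
      ‖algMap (fun k => if k ∈ a then A k else 1) t‖ ≤ (∏ k ∈ a, ‖A k‖) * ‖t‖ := by
    intro a
    induction a using Finset.induction_on with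
    | empty =>
      intro t
      have h : algMap (fun _ : Fin n => (1 : H →L[ℂ] H)) t = t := by
        induction t using AlgTensorPower.induction with
        | smul r x => simp [algMap_tprod]
        | add s t hs ht => rw [map_add, hs, ht]
      simp [h]
    | insert k a hk ih =>
      intro t
      have h : (fun j => if j ∈ insert k a then A j else 1)
          = Function.update (1 : Fin n → H →L[ℂ] H) k (A k) * (fun j => if j ∈ a then A j else (1 : H →L[ℂ] H)) := by
        funext j
        by_cases hj : j = k
        · subst hj; simp [hk]
        · simp [hj]
      rw [h, algMap_mul, Finset.prod_insert hk, mul_assoc]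
      exact (norm_algMap_single k (A k) _).trans
        (mul_le_mul_of_nonneg_left (ih t) (norm_nonneg _))
  simpa using main Finset.univ t

/-- The tensor product `A₁ ⊗ ⋯ ⊗ Aₙ` of bounded operators, as a bounded operator on `H^{⊗n}`. -/
noncomputable def tensorOp (A : Fin n → H →L[ℂ] H) : TensorPower n H →L[ℂ] TensorPower n H :=
  ((algMap A).mkContinuous (∏ k, ‖A k‖) (norm_algMap_le A)).completion

theorem tensorOp_tmul (A : Fin n → H →L[ℂ] H) (x : Fin n → H) :
    tensorOp A (tmul x) = tmul (fun k => A k (x k)) := by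
  rw [tensorOp, tmul, ContinuousLinearMap.completion_apply_coe, LinearMap.mkContinuous_apply,
    algMap_tprod, tmul]

end Tensor
section Channel

variable {X : Type*} [MeasurableSpace X]
  {H : Type*} [NormedAddCommGroup H] [InnerProductSpace ℂ H] [CompleteSpace H]

variable (H) in
/-- Density operators (states): positive trace class operators of trace one, as a subset of the
trace class; measurability refers to the Borel σ-algebra of the trace norm. -/
abbrev DensityOperator : Type _ := {A : TraceClass H // 0 ≤ A.op ∧ trace A.op = 1}

/-- The state `D_P = E D(X)`, `X ∼ P`, as a Bochner integral in the trace class. -/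
noncomputable def avgOutput (P : Measure X) (D : X → DensityOperator H) : TraceClass H :=
  ∫ x, (D x : TraceClass H) ∂P

/-- `A log A` for `A ≥ 0` (with `0 log 0 = 0`), through the continuous functional calculus. -/
noncomputable def mulLog (A : H →L[ℂ] H) : H →L[ℂ] H := cfc (fun t : ℝ => t * Real.log t) A

open Classical in
/-- The quantum mutual information
`I(P, D) = E tr (D(X) log D(X)) - tr (D_P log D_P)`, which is `∞` by convention if
`D(X) log D(X)` fails to be trace class on a non-null set or `D_P log D_P` is not trace class. -/
noncomputable def mutualInfo (P : Measure X) (D : X → DensityOperator H) : EReal :=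
  if (∀ᵐ x ∂P, IsTraceClass (mulLog (D x).1.op)) ∧ IsTraceClass (mulLog (avgOutput P D).op) then
    (((∫ x, (trace (mulLog (D x).1.op)).re ∂P) - (trace (mulLog (avgOutput P D).op)).re : ℝ) :
      EReal)
  else ⊤

open Classical in
/-- An operator as an element of the trace class; the value is `0` if it is not trace class. -/
noncomputable def toTraceClass (A : H →L[ℂ] H) : TraceClass H :=
  if h : IsTraceClass A then TraceClass.mk A h else 0

/-- The `n`-fold channel `Dⁿ(x₁, …, xₙ) = D(x₁) ⊗ ⋯ ⊗ D(xₙ)`. -/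
noncomputable def channelPow {n : ℕ} (D : X → DensityOperator H) (x : Fin n → X) :
    TensorPower n H →L[ℂ] TensorPower n H :=
  tensorOp fun i => (D (x i)).1.op

/-- The output `D_C = (1/M) ∑ₘ Dⁿ(C(m))` induced by a codebook `C` of block length `n` and
size `M`. -/
noncomputable def codebookOutput {n M : ℕ} (D : X → DensityOperator H) (C : Fin M → Fin n → X) :
    TensorPower n H →L[ℂ] TensorPower n H :=
  (1 / (M : ℂ)) • ∑ m, channelPow D (C m)

/-- The law of the standard random codebook: `M` independent codewords, each with `n` independent
letters of law `P`. -/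
noncomputable def codebookLaw (P : Measure X) (n M : ℕ) : Measure (Fin M → Fin n → X) :=
  Measure.pi fun _ => Measure.pi fun _ => P

end Channel

end CQ

/-! Let h be the mean entropy of D(X) and S the entropy of D_P, so that I(P, D) = S - h.
Heuristically the relevant eigenvalues of Dⁿ(x) are about exp(-nh) and those of ρ = D_P^{⊗n} about
exp(-nS): one codeword fills about exp(nh) of the exp(nS) relevant dimensions, and more than exp(n(S
- h)) codewords cover them.

This is made quantitative by a second moment argument with continuous spectral cut-offs. Write R = S
- h + 4δ, F = Dⁿ(x), G = min(F, μ₀) with μ₀ = exp(-n(h - δ)), and B = min(1, ρ/μ₁) with μ₁ =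
exp(-n(S + δ)). In Hilbert–Schmidt norm the codebook mean of G has variance at most E‖G‖₂²/M ≤ μ₀/M,
and ‖B‖₂² ≤ 1/μ₁. By Cauchy–Schwarz the fluctuation of (mean of G) · B has trace norm about √(μ₀/(M
μ₁)) ≤ exp(-nδ). What remains is twice E‖F - GB‖ (`lintegral_traceNorm_mean_sub_le`);
`lintegral_traceNorm_sub_mul_le` reduces it to the part of F above μ₀ and the part of ρ below about
μ₁.

Both tails are Chernoff bounds. With ε = 1/(j + 1) they cost μ₀^(-ε) tr F^(1+ε) and μ₁^ε tr ρ^(1-ε),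
and these moments factor over the tensor positions (`lintegral_codebook_le`). The assumption on α
enters through `rpow_one_add_le`, which gives E tr D(X)^(1+ε) ≤ exp(-εh + O(ε²)) and tr D_P^(1-ε) ≤
exp(εS + O(ε²)). A small ε therefore leaves a positive exponent. Taking 1/ε to be a natural number
makes every power in H^{⊗n} a natural power of a tensor product of roots. -/

namespace CQ

/-! ### Trace norm and Hilbert–Schmidt norm -/

section TraceNorm

variable {H : Type*} [NormedAddCommGroup H] [InnerProductSpace ℂ H] [CompleteSpace H]

omit [CompleteSpace H] in
theorem inner_re_le_of_le {A B : H →L[ℂ] H} (h : A ≤ B) (x : H) :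
    (inner ℂ x (A x)).re ≤ (inner ℂ x (B x)).re := by
  have h1 := ((ContinuousLinearMap.le_def A B).1 h).re_inner_nonneg_right x
  rw [sub_apply, inner_sub_right] at h1
  have h2 : 0 ≤ (inner ℂ x (B x) - inner ℂ x (A x) : ℂ).re := h1
  rw [Complex.sub_re] at h2
  linarith

omit [CompleteSpace H] in
theorem inner_re_nonneg {A : H →L[ℂ] H} (h : 0 ≤ A) (x : H) : 0 ≤ (inner ℂ x (A x)).re := by
  simpa using inner_re_le_of_le h x

theorem traceNorm_of_nonneg {ι : Type*} (e : HilbertBasis ι ℂ H) {A : H →L[ℂ] H} (hA : 0 ≤ A) :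
    traceNorm A = ∑' i, ENNReal.ofReal (inner ℂ (e i) (A (e i))).re := by
  rw [traceNorm_eq e, CFC.abs_of_nonneg A hA]

theorem traceNorm_mono {A B : H →L[ℂ] H} (hA : 0 ≤ A) (hAB : A ≤ B) :
    traceNorm A ≤ traceNorm B := by
  rw [traceNorm_of_nonneg (onb H) hA, traceNorm_of_nonneg (onb H) (hA.trans hAB)]
  exact ENNReal.tsum_le_tsum fun i => ENNReal.ofReal_le_ofReal (inner_re_le_of_le hAB _)

theorem traceNorm_add_of_nonneg {A B : H →L[ℂ] H} (hA : 0 ≤ A) (hB : 0 ≤ B) :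
    traceNorm (A + B) = traceNorm A + traceNorm B := by
  rw [traceNorm_of_nonneg (onb H) hA, traceNorm_of_nonneg (onb H) hB,
    traceNorm_of_nonneg (onb H) (add_nonneg hA hB), ← ENNReal.tsum_add]
  refine tsum_congr fun i => ?_
  rw [← ENNReal.ofReal_add (inner_re_nonneg hA _) (inner_re_nonneg hB _), add_apply,
    inner_add_right, Complex.add_re]

theorem traceNorm_real_smul {c : ℝ} (hc : 0 ≤ c) (A : H →L[ℂ] H) :
    traceNorm (c • A) = ENNReal.ofReal c * traceNorm A := by
  have h : c • A = (c : ℂ) • A := by ext x; simp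
  rw [h, traceNorm_smul]
  congr 1
  rw [← ofReal_norm, Complex.norm_real, Real.norm_of_nonneg hc]

theorem traceNorm_neg (A : H →L[ℂ] H) : traceNorm (-A) = traceNorm A := by
  rw [← neg_one_smul ℂ, traceNorm_smul]
  simp

/-- The squared Hilbert–Schmidt norm. -/
noncomputable def hsSq (A : H →L[ℂ] H) : ℝ≥0∞ := ∑' i, ‖A (onb H i)‖ₑ ^ 2

theorem hsSq_star (A : H →L[ℂ] H) : hsSq (star A) = hsSq A :=
  (hilbertSchmidt_adjoint (onb H) (onb H) A).symm

omit [CompleteSpace H] in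
theorem norm_apply_le_of_norm_le_one {W : H →L[ℂ] H} (hW : ‖W‖ ≤ 1) (x : H) : ‖W x‖ ≤ ‖x‖ := by
  simpa using W.le_of_opNorm_le hW x

theorem hsSq_mul_le_right {W : H →L[ℂ] H} (hW : ‖W‖ ≤ 1) (A : H →L[ℂ] H) :
    hsSq (W * A) ≤ hsSq A := by
  refine ENNReal.tsum_le_tsum fun i => ?_
  gcongr
  rw [mul_apply_eq_comp, ← ofReal_norm, ← ofReal_norm]
  exact ENNReal.ofReal_le_ofReal (norm_apply_le_of_norm_le_one hW _)

theorem hsSq_mul_le_left {W : H →L[ℂ] H} (hW : ‖W‖ ≤ 1) (A : H →L[ℂ] H) :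
    hsSq (A * W) ≤ hsSq A := by
  rw [← hsSq_star, star_mul, ← hsSq_star A]
  exact hsSq_mul_le_right (by rwa [norm_star]) _

theorem traceNorm_star_mul_self (A : H →L[ℂ] H) : traceNorm (star A * A) = hsSq A := by
  rw [traceNorm_of_nonneg (onb H) (star_mul_self_nonneg A)]
  refine tsum_congr fun i => ?_
  rw [mul_apply_eq_comp, ContinuousLinearMap.star_eq_adjoint,
    ContinuousLinearMap.adjoint_inner_right, ← ofReal_norm, ← ENNReal.ofReal_pow (norm_nonneg _)]
  exact congrArg _ (inner_self_eq_norm_sq (𝕜 := ℂ) _)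

omit [CompleteSpace H] in
-- Weighted AM–GM replaces the product of norms by a sum. The free weight c survives into all later
-- bounds and is optimised only once the exponents are known; this keeps square roots out and allows
-- infinite values.
theorem enorm_inner_le_weighted (x y : H) {c : ℝ} (hc : 0 < c) :
    ‖inner ℂ x y‖ₑ
      ≤ 2⁻¹ * (ENNReal.ofReal c * ‖x‖ₑ ^ 2 + ENNReal.ofReal c⁻¹ * ‖y‖ₑ ^ 2) := by
  have h1 := norm_inner_le_norm (𝕜 := ℂ) x y
  have h2 : ‖inner ℂ x y‖ ≤ 2⁻¹ * (c * ‖x‖ ^ 2 + c⁻¹ * ‖y‖ ^ 2) := by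
    have e : c * ‖x‖ ^ 2 + c⁻¹ * ‖y‖ ^ 2 - 2 * (‖x‖ * ‖y‖) = c⁻¹ * (c * ‖x‖ - ‖y‖) ^ 2 := by
      field_simp; ring
    have : 0 ≤ c⁻¹ * (c * ‖x‖ - ‖y‖) ^ 2 := by positivity
    linarith
  have h3 := ENNReal.ofReal_le_ofReal h2
  rw [ENNReal.ofReal_mul (by norm_num), ENNReal.ofReal_add (by positivity) (by positivity),
    ENNReal.ofReal_mul hc.le, ENNReal.ofReal_mul (by positivity),
    ENNReal.ofReal_pow (norm_nonneg _), ENNReal.ofReal_pow (norm_nonneg _),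
    ENNReal.ofReal_inv_of_pos (by norm_num : (0 : ℝ) < 2)] at h3
  simpa using h3

theorem exists_contraction_abs (A : H →L[ℂ] H) :
    ∃ W : H →L[ℂ] H, (∀ x, ‖W x‖ ≤ ‖x‖) ∧ CFC.abs A = W * A :=
  exists_contraction (CFC.abs A) A (fun x => (norm_abs_apply A x).le)

/-- Moving W to the left entry leaves terms that depend on A through linear functionals only, the
form needed to pull an average out of A. -/
theorem traceNorm_le_tsum_enorm {ι : Type*} (e : HilbertBasis ι ℂ H) {A W : H →L[ℂ] H}
    (h : CFC.abs A = W * A) : traceNorm A ≤ ∑' i, ‖inner ℂ (star W (e i)) (A (e i))‖ₑ := by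
  rw [traceNorm_eq e]
  refine ENNReal.tsum_le_tsum fun i => ?_
  rw [h, mul_apply_eq_comp, ContinuousLinearMap.star_eq_adjoint,
    ContinuousLinearMap.adjoint_inner_left, ← ofReal_norm]
  exact ENNReal.ofReal_le_ofReal (Complex.re_le_norm _)

/-- The Cauchy–Schwarz inequality for the Hilbert–Schmidt norm, in its additive form. -/
theorem traceNorm_mul_le_hsSq (A B : H →L[ℂ] H) {c : ℝ} (hc : 0 < c) :
    traceNorm (A * B)
      ≤ 2⁻¹ * (ENNReal.ofReal c * hsSq A + ENNReal.ofReal c⁻¹ * hsSq B) := by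
  obtain ⟨W, hW, h⟩ := exists_contraction_abs (A * B)
  have hW1 : ‖W‖ ≤ 1 := W.opNorm_le_bound zero_le_one (by simpa using hW)
  calc traceNorm (A * B) ≤ ∑' i, ‖inner ℂ (star W (onb H i)) ((A * B) (onb H i))‖ₑ :=
        traceNorm_le_tsum_enorm (onb H) h
    _ ≤ ∑' i, 2⁻¹ * (ENNReal.ofReal c * ‖star (W * A) (onb H i)‖ₑ ^ 2
          + ENNReal.ofReal c⁻¹ * ‖B (onb H i)‖ₑ ^ 2) := by
        refine ENNReal.tsum_le_tsum fun i => ?_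
        -- With W and A both on the left, the two entries decouple: the left vectors have the
        -- Hilbert–Schmidt norm of (W A)*, which is that of W A.
        have e1 : inner ℂ (star W (onb H i)) ((A * B) (onb H i))
            = inner ℂ (star (W * A) (onb H i)) (B (onb H i)) := by
          simp only [star_mul, mul_apply_eq_comp, ContinuousLinearMap.star_eq_adjoint,
            ContinuousLinearMap.adjoint_inner_left]
        rw [e1]
        exact enorm_inner_le_weighted _ _ hc
    _ = 2⁻¹ * (ENNReal.ofReal c * hsSq (star (W * A)) + ENNReal.ofReal c⁻¹ * hsSq B) := by
        rw [ENNReal.tsum_mul_left, ENNReal.tsum_add, ENNReal.tsum_mul_left, ENNReal.tsum_mul_left]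
        rfl
    _ ≤ _ := by
        rw [hsSq_star]
        gcongr
        exact hsSq_mul_le_right hW1 A

/-- A = S S with S = √A Hilbert–Schmidt, so A B = S (S B), and Cauchy–Schwarz with weight 1 suffices
because right multiplication by a contraction does not increase the Hilbert–Schmidt norm. -/
theorem traceNorm_mul_le_of_nonneg {A B : H →L[ℂ] H} (hA : 0 ≤ A) (hB : ‖B‖ ≤ 1) :
    traceNorm (A * B) ≤ traceNorm A := by
  set S := CFC.sqrt A with hS
  have hs : star S = S := (CFC.sqrt_nonneg A).isSelfAdjoint
  have hSS : star S * S = A := by rw [hs]; exact CFC.sqrt_mul_sqrt_self A hA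
  have hSA : hsSq S = traceNorm A := by rw [← traceNorm_star_mul_self, hSS]
  calc traceNorm (A * B) = traceNorm (S * (S * B)) := by rw [← mul_assoc, ← hSS, hs]
    _ ≤ 2⁻¹ * (ENNReal.ofReal 1 * hsSq S + ENNReal.ofReal 1⁻¹ * hsSq (S * B)) :=
      traceNorm_mul_le_hsSq _ _ one_pos
    _ ≤ 2⁻¹ * (hsSq S + hsSq S) := by
      simp only [inv_one, ENNReal.ofReal_one, one_mul]
      gcongr
      exact hsSq_mul_le_left hB S
    _ = traceNorm A := by
      rw [← two_mul, ← mul_assoc, ENNReal.inv_mul_cancel (by norm_num) (by norm_num), one_mul, hSA]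

theorem trace_re_of_nonneg {A : H →L[ℂ] H} (hA : 0 ≤ A) (h : IsTraceClass A) :
    (trace A).re = (traceNorm A).toReal := by
  have h1 := tsum_enorm_inner_le (1 : H →L[ℂ] H) A (fun x => le_rfl)
  rw [one_mul] at h1
  -- Absolute convergence of the diagonal justifies taking real parts term by term.
  have h2 : Summable fun i => ‖inner ℂ (onb H i) (A (onb H i))‖ := by
    have h3 : ∑' i, ‖inner ℂ (onb H i) (A (onb H i))‖ₑ ≠ ∞ := (h1.trans_lt h).ne
    have h4 := ENNReal.summable_toReal h3
    simpa using h4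
  rw [trace, Complex.re_tsum h2.of_norm, traceNorm_of_nonneg (onb H) hA,
    ENNReal.tsum_toReal_eq fun i => ENNReal.ofReal_ne_top]
  exact tsum_congr fun i => (ENNReal.toReal_ofReal (inner_re_nonneg hA _)).symm

theorem trace_neg (A : H →L[ℂ] H) : trace (-A) = -trace A := by
  simp only [trace, neg_apply, inner_neg_right, tsum_neg]

theorem DensityOperator.traceNorm_eq_one (A : {A : TraceClass H // 0 ≤ A.op ∧ trace A.op = 1}) :
    traceNorm A.1.op = 1 := by
  have h := trace_re_of_nonneg A.2.1 A.1.isTraceClass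
  rw [A.2.2, Complex.one_re] at h
  rw [← ENNReal.toReal_eq_one_iff, h]

theorem norm_le_one_of_traceNorm_le_one {A : H →L[ℂ] H} (h : traceNorm A ≤ 1) : ‖A‖ ≤ 1 := by
  have := (opNorm_le_traceNorm A).trans h
  rw [← ofReal_norm] at this
  exact ENNReal.ofReal_le_one.1 this

/-- Basis vectors lie at distance √2, so balls of radius 1/2 around them are disjoint. Countability
is what permits exchanging basis sums with integrals. -/
instance [TopologicalSpace.SeparableSpace H] : Countable (BasisIndex H) := by
  have ho := (onb H).orthonormal
  have hd : Pairwise fun i j : BasisIndex H =>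
      Disjoint (Metric.ball (onb H i) (1 / 2)) (Metric.ball (onb H j) (1 / 2)) := by
    intro i j hij
    refine Metric.ball_disjoint_ball ?_
    have h1 : ‖onb H i - onb H j‖ ^ 2 = 2 := by
      rw [@norm_sub_sq ℂ, ho.2 hij, ho.1, ho.1]; norm_num
    rw [dist_eq_norm]
    nlinarith [norm_nonneg (onb H i - onb H j)]
  exact hd.countable_of_isOpen_disjoint (fun _ => Metric.isOpen_ball)
    fun i => ⟨_, Metric.mem_ball_self (by norm_num)⟩


end TraceNorm

/-! ### Separability of the trace class -/

section Separable

variable {H : Type*} [NormedAddCommGroup H] [InnerProductSpace ℂ H] [CompleteSpace H]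

open InnerProductSpace in
theorem hsSq_rankOne (x y : H) : hsSq (rankOne ℂ x y) = ‖x‖ₑ ^ 2 * ‖y‖ₑ ^ 2 := by
  rw [enorm_sq_eq_tsum (onb H) y, ← ENNReal.tsum_mul_left]
  refine tsum_congr fun i => ?_
  rw [rankOne_apply, enorm_smul, mul_pow, mul_comm, ← ofReal_norm (inner ℂ _ _), norm_inner_symm,
    ofReal_norm]

open InnerProductSpace in
theorem traceNorm_rankOne_le (x : H) {e : H} (he : ‖e‖ = 1) :
    traceNorm (rankOne ℂ x e) ≤ ‖x‖ₑ := by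
  rcases eq_or_ne x 0 with rfl | hx
  · simp [traceNorm_zero]
  have hx' : 0 < ‖x‖ := norm_pos_iff.2 hx
  -- Splitting off |e⟩⟨e| exhibits a product of two Hilbert–Schmidt operators of squared norms ‖x‖²
  -- and 1; the weight 1/‖x‖ balances them.
  have h : rankOne ℂ x e = rankOne ℂ x e * rankOne ℂ e e := by
    ext y
    simp [inner_self_eq_norm_sq_to_K, he]
  rw [h]
  refine (traceNorm_mul_le_hsSq _ _ (inv_pos.2 hx')).trans_eq ?_
  have he' : ‖e‖ₑ = 1 := by rw [← ofReal_norm, he, ENNReal.ofReal_one]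
  rw [hsSq_rankOne, hsSq_rankOne, he', inv_inv, ← ofReal_norm]
  simp only [one_pow, mul_one]
  rw [← ENNReal.ofReal_pow hx'.le, ← ENNReal.ofReal_mul (by positivity), sq, inv_mul_cancel_left₀ hx'.ne',
    ← two_mul, ← mul_assoc, ENNReal.inv_mul_cancel (by norm_num) (by norm_num), one_mul]

namespace TraceClass

variable (H) in
/-- The inclusion of the trace class into the bounded operators. -/
noncomputable def opCLM : TraceClass H →L[ℂ] (H →L[ℂ] H) :=
  LinearMap.mkContinuous
    { toFun := op
      map_add' := fun _ _ => rfl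
      map_smul' := fun _ _ => rfl } 1 fun A =>
      (opNorm_le_norm A).trans_eq (one_mul _).symm

@[simp] theorem opCLM_apply (A : TraceClass H) : opCLM H A = A.op := rfl

open InnerProductSpace in
/-- The map `x ↦ |x⟩⟨e|` into the trace class. -/
noncomputable def ketBra {e : H} (he : ‖e‖ = 1) : H →L[ℂ] TraceClass H :=
  LinearMap.mkContinuous
    { toFun := fun x => mk (rankOne ℂ x e) ((traceNorm_rankOne_le x he).trans_lt enorm_lt_top)
      map_add' := fun x y => ext (by
        change rankOne ℂ (x + y) e = rankOne ℂ x e + rankOne ℂ y e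
        simp)
      map_smul' := fun c x => ext (by
        change rankOne ℂ (c • x) e = c • rankOne ℂ x e
        simp) } 1 fun x => by
    rw [one_mul, norm_def]
    exact ENNReal.toReal_le_of_le_ofReal (norm_nonneg _)
      ((traceNorm_rankOne_le x he).trans_eq (ofReal_norm x).symm)

theorem ketBra_op {e : H} (he : ‖e‖ = 1) (x : H) :
    (ketBra he x).op = InnerProductSpace.rankOne ℂ x e := rfl

/-- With Q = |A|^(1/2) and A = V |A|, the error A (1 - P) equals (V Q)(Q (1 - P)), where P projects
onto finitely many basis vectors. The second factor is a tail of the convergent series for the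
Hilbert–Schmidt norm of Q. -/
theorem exists_finset_norm_sub_le (A : TraceClass H) {ε : ℝ} (hε : 0 < ε) :
    ∃ s : Finset (BasisIndex H),
      ‖A - ∑ i ∈ s, ketBra ((onb H).orthonormal.1 i) (A.op (onb H i))‖ ≤ ε := by
  classical
  obtain ⟨V, hV, hA⟩ := exists_contraction A.op (CFC.abs A.op) (fun x => (norm_abs_apply A.op x).ge)
  have hV1 : ‖V‖ ≤ 1 := V.opNorm_le_bound zero_le_one (by simpa using hV)
  set Q := CFC.sqrt (CFC.abs A.op) with hQ
  have hs : star Q = Q := (CFC.sqrt_nonneg (CFC.abs A.op)).isSelfAdjoint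
  have hQQ : CFC.abs A.op = Q * Q := (CFC.sqrt_mul_sqrt_self _ (CFC.abs_nonneg A.op)).symm
  have htr : hsSq Q = traceNorm A.op := by
    simp_rw [traceNorm, ofReal_inner_abs]; rfl
  have hQfin : hsSq Q ≠ ∞ := htr ▸ A.isTraceClass.ne
  have hAB : A.op = (V * Q) * Q := by rw [hA, hQQ, mul_assoc]
  have hBfin : hsSq (V * Q) ≠ ∞ := ((hsSq_mul_le_right hV1 Q).trans_lt hQfin.lt_top).ne
  -- This weight makes c times the first squared norm at most ε; the tail is taken below c ε, so
  -- that c⁻¹ times the second is at most ε as well. The summand 1 avoids division by zero.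
  set c : ℝ := ε / ((hsSq (V * Q)).toReal + 1) with hc
  have hb : 0 < (hsSq (V * Q)).toReal + 1 := by positivity
  have hc0 : 0 < c := div_pos hε hb
  have ht := (ENNReal.tendsto_tsum_compl_atTop_zero hQfin).eventually
    (Iic_mem_nhds (ENNReal.ofReal_pos.2 (mul_pos hc0 hε)))
  obtain ⟨s, hs'⟩ := ht.exists
  refine ⟨s, ?_⟩
  set P : H →L[ℂ] H := ∑ i ∈ s, InnerProductSpace.rankOne ℂ (onb H i) (onb H i) with hP
  have hPe : ∀ j, P (onb H j) = if j ∈ s then onb H j else 0 := by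
    intro j
    simp only [hP, sum_apply, InnerProductSpace.rankOne_apply,
      orthonormal_iff_ite.1 (onb H).orthonormal]
    simp
  have hop : (A - ∑ i ∈ s, ketBra ((onb H).orthonormal.1 i) (A.op (onb H i))).op
      = (V * Q) * (Q * (1 - P)) := by
    rw [← mul_assoc, ← hAB, ← opCLM_apply, map_sub, map_sum, mul_sub, mul_one, hP, Finset.mul_sum]
    congr 1
    refine Finset.sum_congr rfl fun i _ => ?_
    ext y
    simp [ketBra_op]
  have htail : hsSq (Q * (1 - P)) ≤ ENNReal.ofReal (c * ε) := by
    refine le_trans ?_ hs'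
    refine le_trans ?_ (tsum_subtype {b | b ∉ s} (fun b => ‖Q (onb H b)‖ₑ ^ 2)).ge
    refine ENNReal.tsum_le_tsum fun j => ?_
    rw [mul_apply_eq_comp, sub_apply, hPe]
    by_cases hj : j ∈ s
    · simp [hj]
    · simp [hj]
  rw [norm_def, hop]
  refine ENNReal.toReal_le_of_le_ofReal hε.le ?_
  refine (traceNorm_mul_le_hsSq _ _ hc0).trans ?_
  have h1 : ENNReal.ofReal c * hsSq (V * Q) ≤ ENNReal.ofReal ε := by
    rw [← ENNReal.ofReal_toReal hBfin, ← ENNReal.ofReal_mul hc0.le]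
    refine ENNReal.ofReal_le_ofReal ?_
    rw [hc, div_mul_eq_mul_div, div_le_iff₀ hb]
    nlinarith
  have h2 : ENNReal.ofReal c⁻¹ * hsSq (Q * (1 - P)) ≤ ENNReal.ofReal ε := by
    refine (mul_le_mul_right htail _).trans_eq ?_
    rw [← ENNReal.ofReal_mul (by positivity), inv_mul_cancel_left₀ hc0.ne']
  calc _ ≤ 2⁻¹ * (ENNReal.ofReal ε + ENNReal.ofReal ε) := by gcongr
    _ = _ := by
      rw [← two_mul, ← mul_assoc, ENNReal.inv_mul_cancel (by norm_num) (by norm_num), one_mul]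

/-- The operators |x⟩⟨eᵢ|, with x in the separable space H and i in a countable set, span a dense
subspace. Separability turns Borel measurability of D into strong measurability, as Bochner
integration requires. -/
instance [TopologicalSpace.SeparableSpace H] : TopologicalSpace.SeparableSpace (TraceClass H) := by
  rw [← TopologicalSpace.isSeparable_univ_iff]
  set S : Set (TraceClass H) :=
    ⋃ i : BasisIndex H, Set.range (ketBra ((onb H).orthonormal.1 i)) with hS
  have hsep : TopologicalSpace.IsSeparable S :=
    TopologicalSpace.IsSeparable.iUnion fun i =>
      TopologicalSpace.isSeparable_range (ContinuousLinearMap.continuous _)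
  have : SecondCountableTopology ℂ := inferInstance
  refine (hsep.span (R := ℂ)).closure.mono fun A _ => ?_
  rw [Metric.mem_closure_iff]
  intro ε hε
  obtain ⟨s, hs⟩ := exists_finset_norm_sub_le A (half_pos hε)
  refine ⟨∑ i ∈ s, ketBra ((onb H).orthonormal.1 i) (A.op (onb H i)),
    Submodule.sum_mem _ fun i _ => Submodule.subset_span
      (Set.mem_iUnion.2 ⟨i, Set.mem_range_self (A.op (onb H i))⟩), ?_⟩
  rw [dist_eq_norm]
  exact hs.trans_lt (half_lt_self hε)

end TraceClass

end Separable

/-! ### Averages and measurability of operator-valued maps -/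

section Averages

variable {Ω : Type*} [MeasurableSpace Ω] {μ : Measure Ω}
  {H : Type*} [NormedAddCommGroup H] [InnerProductSpace ℂ H] [CompleteSpace H]

theorem inner_integral_apply {F : Ω → H →L[ℂ] H} (hF : Integrable F μ) (x y : H) :
    inner ℂ x ((∫ ω, F ω ∂μ) y) = ∫ ω, inner ℂ x (F ω y) ∂μ := by
  rw [ContinuousLinearMap.integral_apply hF]
  exact (integral_inner ((ContinuousLinearMap.apply ℂ H y).integrable_comp hF) _).symm

/-- The trace norm of an average is at most the average of the trace norms. -/
theorem traceNorm_integral_le [Countable (BasisIndex H)] {F : Ω → H →L[ℂ] H}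
    (hF : Integrable F μ) : traceNorm (∫ ω, F ω ∂μ) ≤ ∫⁻ ω, traceNorm (F ω) ∂μ := by
  -- One contraction W, chosen for the averaged operator, is tested against every F ω; the average
  -- then leaves a linear expression.
  obtain ⟨W, hW, h⟩ := exists_contraction_abs (∫ ω, F ω ∂μ)
  have hm : ∀ i, AEMeasurable (fun ω => ‖inner ℂ (star W (onb H i)) (F ω (onb H i))‖ₑ) μ := fun i =>
    (aestronglyMeasurable_const.inner
      ((ContinuousLinearMap.apply ℂ H (onb H i)).continuous.comp_aestronglyMeasurable hF.1)).enorm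
  calc _ ≤ ∑' i, ‖inner ℂ (star W (onb H i)) ((∫ ω, F ω ∂μ) (onb H i))‖ₑ :=
        traceNorm_le_tsum_enorm (onb H) h
    _ ≤ ∑' i, ∫⁻ ω, ‖inner ℂ (star W (onb H i)) (F ω (onb H i))‖ₑ ∂μ := by
        refine ENNReal.tsum_le_tsum fun i => ?_
        rw [inner_integral_apply hF]
        exact enorm_integral_le_lintegral_enorm _
    _ = ∫⁻ ω, ∑' i, ‖inner ℂ (star W (onb H i)) (F ω (onb H i))‖ₑ ∂μ := (lintegral_tsum hm).symm
    _ ≤ _ := by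
        refine lintegral_mono fun ω => ?_
        refine le_trans (le_of_eq (tsum_congr fun i => ?_)) (tsum_enorm_inner_le W (F ω) hW)
        rw [mul_apply_eq_comp, ContinuousLinearMap.star_eq_adjoint,
          ContinuousLinearMap.adjoint_inner_left]

/-- The trace norm need not be continuous for the operator norm, but each diagonal term is, and
there are countably many of them. -/
theorem measurable_traceNorm_of_stronglyMeasurable [Countable (BasisIndex H)] {F : Ω → H →L[ℂ] H}
    (hF : StronglyMeasurable F) : Measurable fun ω => traceNorm (F ω) := by
  refine Measurable.tsum fun i => ?_
  have hc : Continuous fun B : H →L[ℂ] H =>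
      ENNReal.ofReal (inner ℂ (onb H i) (CFC.abs B (onb H i))).re := by
    refine ENNReal.continuous_ofReal.comp ?_
    refine Complex.continuous_re.comp (continuous_const.inner ?_)
    exact (ContinuousLinearMap.apply ℂ H ((onb H i : H))).continuous.comp CFC.continuous_abs
  exact (hc.comp_stronglyMeasurable hF).measurable

theorem measurable_hsSq_of_stronglyMeasurable [Countable (BasisIndex H)] {F : Ω → H →L[ℂ] H}
    (hF : StronglyMeasurable F) : Measurable fun ω => hsSq (F ω) := by
  refine Measurable.tsum fun i => ?_
  have hc : Continuous fun B : H →L[ℂ] H => ‖B (onb H i)‖ₑ ^ 2 :=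
    (ENNReal.continuous_pow 2).comp
      (continuous_enorm.comp (ContinuousLinearMap.apply ℂ H ((onb H i : H))).continuous)
  exact (hc.comp_stronglyMeasurable hF).measurable

theorem spectrum_subset_Icc {A : H →L[ℂ] H} (h0 : 0 ≤ A) (h1 : ‖A‖ ≤ 1) :
    spectrum ℝ A ⊆ Set.Icc 0 1 := fun t ht =>
  ⟨spectrum_nonneg_of_nonneg h0 ht, (le_abs_self t).trans
    ((spectrum.norm_le_norm_mul_of_mem ht).trans
    -- Only ‖1‖ ≤ 1 is used, since H may be the zero space.
    (mul_le_one₀ h1 (norm_nonneg _) ContinuousLinearMap.norm_id_le))⟩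

/-- The functional calculus of a fixed φ is norm continuous on self-adjoint operators with spectrum
in a fixed compact set. Continuity on [0, 1] is all that is asked of φ. -/
theorem stronglyMeasurable_cfc {F : Ω → H →L[ℂ] H} (hF : StronglyMeasurable F)
    (h0 : ∀ ω, 0 ≤ F ω) (h1 : ∀ ω, ‖F ω‖ ≤ 1) {φ : ℝ → ℝ} (hφ : ContinuousOn φ (Set.Icc 0 1)) :
    StronglyMeasurable fun ω => cfc φ (F ω) := by
  have hc := continuousOn_iff_continuous_domRestrict.1
    (continuousOn_cfc (H →L[ℂ] H) (isCompact_Icc (a := (0 : ℝ)) (b := 1)) φ hφ)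
  have hmem : ∀ ω, F ω ∈ {a : H →L[ℂ] H | IsSelfAdjoint a ∧ spectrum ℝ a ⊆ Set.Icc 0 1} := fun ω =>
    ⟨(h0 ω).isSelfAdjoint, spectrum_subset_Icc (h0 ω) (h1 ω)⟩
  have hG : StronglyMeasurable fun ω =>
      (⟨F ω, hmem ω⟩ : {a : H →L[ℂ] H | IsSelfAdjoint a ∧ spectrum ℝ a ⊆ Set.Icc 0 1}) :=
    (Embedding.comp_stronglyMeasurable_iff Topology.IsEmbedding.subtypeVal).1 hF
  exact hc.comp_stronglyMeasurable hG

end Averages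

/-! ### Tensor powers: product basis, positivity, trace norm -/

section TensorPower

variable {n : ℕ} {H : Type*} [NormedAddCommGroup H] [InnerProductSpace ℂ H]

theorem TensorPower.clm_ext {E : Type*} [NormedAddCommGroup E] [NormedSpace ℂ E]
    {S T : TensorPower n H →L[ℂ] E} (h : ∀ x, S (tmul x) = T (tmul x)) : S = T := by
  ext v
  induction v using UniformSpace.Completion.induction_on with
  | hp => exact isClosed_eq S.continuous T.continuous
  | ih t =>
    have hcoe : ∀ s : AlgTensorPower n H,
        (s : TensorPower n H) = UniformSpace.Completion.toComplL (𝕜 := ℂ) s := fun _ => rfl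
    rw [hcoe]
    induction t using AlgTensorPower.induction with
    | smul r x => rw [map_smul, map_smul, map_smul]; exact congrArg _ (h x)
    | add s t hs ht => rw [map_add, map_add, map_add, hs, ht]

theorem TensorPower.ext_inner {v w : TensorPower n H}
    (h : ∀ x, inner ℂ (tmul x) v = inner ℂ (tmul x) w) : v = w := by
  have h1 : innerSL ℂ v = innerSL ℂ w := TensorPower.clm_ext fun x => by
    rw [innerSL_apply_apply, innerSL_apply_apply, ← inner_conj_symm, h, inner_conj_symm]
  exact (innerSL_inj (𝕜 := ℂ)).1 h1

theorem norm_tmul (x : Fin n → H) : ‖tmul x‖ = ∏ k, ‖x k‖ := by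
  have h := inner_tmul x x
  simp only [inner_self_eq_norm_sq_to_K] at h
  rw [Finset.prod_pow] at h
  have h2 : ‖tmul x‖ ^ 2 = (∏ k, ‖x k‖) ^ 2 := by exact_mod_cast h
  exact (sq_eq_sq₀ (norm_nonneg _) (Finset.prod_nonneg fun _ _ => norm_nonneg _)).1 h2

variable (n H) in
/-- The elementary tensor `x₁ ⊗ ⋯ ⊗ xₙ`, as a continuous multilinear map. -/
noncomputable def tmulCMM : ContinuousMultilinearMap ℂ (fun _ : Fin n => H) (TensorPower n H) :=
  MultilinearMap.mkContinuous
    ((UniformSpace.Completion.toComplL (𝕜 := ℂ) (E := AlgTensorPower n H)).toLinearMap.compMultilinearMap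
      (AlgTensorPower.tprod n)) 1 fun x => by
    rw [one_mul]; exact (norm_tmul x).le

theorem TensorPower.span_range_tmul_closure :
    (Submodule.span ℂ (Set.range (tmul (n := n) (H := H)))).topologicalClosure = ⊤ := by
  refine Submodule.topologicalClosure_eq_top_iff.2 ((Submodule.eq_bot_iff _).2 fun v hv => ?_)
  refine TensorPower.ext_inner fun x => ?_
  rw [inner_zero_right]
  exact hv _ (Submodule.subset_span ⟨x, rfl⟩)

instance [TopologicalSpace.SeparableSpace H] : TopologicalSpace.SeparableSpace (TensorPower n H) := by
  rw [← TopologicalSpace.isSeparable_univ_iff]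
  have h1 : TopologicalSpace.IsSeparable (Set.range (tmul (n := n) (H := H))) :=
    TopologicalSpace.isSeparable_range (tmulCMM n H).cont
  have h2 := (h1.span (R := ℂ)).closure
  rw [← Submodule.topologicalClosure_coe, TensorPower.span_range_tmul_closure] at h2
  exact h2

theorem TensorPower.eq_zero_of_inner_basis {ι : Type*} (e : HilbertBasis ι ℂ H)
    {v : TensorPower n H} (h : ∀ i : Fin n → ι, inner ℂ v (tmul fun k => e (i k)) = 0) : v = 0 := by
  classical
  -- The set a records the slots already released from the basis; releasing one more slot uses that
  -- a continuous linear functional vanishing on a basis is zero.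
  have main : ∀ (a : Finset (Fin n)) (x : Fin n → H), (∀ k ∉ a, x k ∈ Set.range e) →
      inner ℂ v (tmul x) = 0 := by
    intro a
    induction a using Finset.induction_on with
    | empty =>
      intro x hx
      choose i hi using fun k => hx k (Finset.notMem_empty k)
      rw [← h i]
      congr 2
      funext k
      exact (hi k).symm
    | insert k a hk ih =>
      intro x hx
      let L : H →L[ℂ] ℂ := (innerSL ℂ v).comp ((tmulCMM n H).toContinuousLinearMap x k)
      have hL : ∀ y, L y = inner ℂ v (tmul (Function.update x k y)) := fun y => rfl
      have h0 : L = 0 := by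
        refine ContinuousLinearMap.ext_on (s := Set.range e) ?_ ?_
        · have := e.dense_span
          rw [Submodule.dense_iff_topologicalClosure_eq_top]
          exact this
        · rintro _ ⟨i, rfl⟩
          rw [hL]
          refine ih _ fun j hj => ?_
          by_cases hjk : j = k
          · subst hjk; simp
          · rw [Function.update_of_ne hjk]
            exact hx j (by simp [hjk, hj])
      have := hL (x k)
      rw [Function.update_eq_self, h0] at this
      exact this.symm
  refine TensorPower.ext_inner fun x => ?_
  rw [inner_zero_right, ← inner_conj_symm, main Finset.univ x (by simp), map_zero]

/-- The product basis of `H^{⊗n}`. -/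
noncomputable def tensorBasis {ι : Type*} (e : HilbertBasis ι ℂ H) :
    HilbertBasis (Fin n → ι) ℂ (TensorPower n H) := by
  classical
  refine HilbertBasis.mkOfOrthogonalEqBot (v := fun i => tmul fun k => e (i k)) ?_ ?_
  · rw [orthonormal_iff_ite]
    intro i j
    simp only [inner_tmul, orthonormal_iff_ite.1 e.orthonormal, Finset.prod_ite_zero,
      Finset.prod_const_one, funext_iff, Finset.mem_univ, true_imp_iff]
  · refine (Submodule.eq_bot_iff _).2 fun v hv => TensorPower.eq_zero_of_inner_basis e fun i => ?_
    rw [← inner_conj_symm, hv _ (Submodule.subset_span ⟨i, rfl⟩), map_zero]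

theorem tensorBasis_apply {ι : Type*} (e : HilbertBasis ι ℂ H) (i : Fin n → ι) :
    tensorBasis e i = tmul fun k => e (i k) := by
  simp [tensorBasis]

variable [CompleteSpace H]

theorem tensorOp_mul (A B : Fin n → H →L[ℂ] H) :
    tensorOp A * tensorOp B = tensorOp (A * B) :=
  TensorPower.clm_ext fun x => by simp [tensorOp_tmul]

theorem tensorOp_one : tensorOp (1 : Fin n → H →L[ℂ] H) = 1 :=
  TensorPower.clm_ext fun x => by simp [tensorOp_tmul]

theorem tensorOp_pow (A : Fin n → H →L[ℂ] H) (k : ℕ) : tensorOp A ^ k = tensorOp (A ^ k) := by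
  induction k with
  | zero => rw [pow_zero, pow_zero, tensorOp_one]
  | succ k ih => rw [pow_succ, ih, tensorOp_mul, pow_succ]

theorem star_tensorOp (A : Fin n → H →L[ℂ] H) : star (tensorOp A) = tensorOp (star A) := by
  refine TensorPower.clm_ext fun x => TensorPower.ext_inner fun y => ?_
  rw [ContinuousLinearMap.star_eq_adjoint, ContinuousLinearMap.adjoint_inner_right, tensorOp_tmul,
    tensorOp_tmul, inner_tmul, inner_tmul]
  refine Finset.prod_congr rfl fun k _ => ?_
  rw [Pi.star_apply, ContinuousLinearMap.star_eq_adjoint, ContinuousLinearMap.adjoint_inner_right]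

/-- Factor each Aₖ as Bₖ* Bₖ; adjoints and products pass through the tensor product. -/
theorem tensorOp_nonneg {A : Fin n → H →L[ℂ] H} (hA : ∀ k, 0 ≤ A k) : 0 ≤ tensorOp A := by
  choose B hB using fun k => CStarAlgebra.nonneg_iff_eq_star_mul_self.1 (hA k)
  have h : tensorOp A = star (tensorOp B) * tensorOp B := by
    rw [star_tensorOp, tensorOp_mul]
    congr 1
    funext k
    exact hB k
  rw [h]
  exact star_mul_self_nonneg _

theorem norm_tensorOp_le (A : Fin n → H →L[ℂ] H) : ‖tensorOp A‖ ≤ ∏ k, ‖A k‖ := by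
  have h0 : 0 ≤ ∏ k, ‖A k‖ := Finset.prod_nonneg fun _ _ => norm_nonneg _
  refine ContinuousLinearMap.opNorm_le_bound _ h0 fun v => ?_
  induction v using UniformSpace.Completion.induction_on with
  | hp => exact isClosed_le (tensorOp A).continuous.norm (continuous_const.mul continuous_norm)
  | ih t =>
    rw [tensorOp, ContinuousLinearMap.completion_apply_coe, UniformSpace.Completion.norm_coe,
      UniformSpace.Completion.norm_coe]
    exact norm_algMap_le A t

variable (n H) in
/-- The tensor product of operators, as a continuous multilinear map. -/
noncomputable def tensorOpCMM : ContinuousMultilinearMap ℂ (fun _ : Fin n => H →L[ℂ] H)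
    (TensorPower n H →L[ℂ] TensorPower n H) :=
  MultilinearMap.mkContinuous
    { toFun := tensorOp
      map_update_add' := fun A k S T => TensorPower.clm_ext fun x => by
        have h : ∀ W : H →L[ℂ] H, (fun j => Function.update A k W j (x j))
            = Function.update (fun j => A j (x j)) k (W (x k)) := by
          intro W; funext j
          by_cases hj : j = k
          · subst hj; simp
          · simp [hj]
        rw [add_apply, tensorOp_tmul, tensorOp_tmul, tensorOp_tmul, h, h, h, add_apply]
        exact (tmulCMM n H).map_update_add _ _ _ _
      map_update_smul' := fun A k c T => TensorPower.clm_ext fun x => by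
        have h : ∀ W : H →L[ℂ] H, (fun j => Function.update A k W j (x j))
            = Function.update (fun j => A j (x j)) k (W (x k)) := by
          intro W; funext j
          by_cases hj : j = k
          · subst hj; simp
          · simp [hj]
        rw [smul_apply, tensorOp_tmul, tensorOp_tmul, h, h, smul_apply]
        exact (tmulCMM n H).map_update_smul _ _ _ _ } 1 fun A => by
    rw [one_mul]; exact norm_tensorOp_le A

theorem continuous_tensorOp :
    Continuous (tensorOp : (Fin n → H →L[ℂ] H) → TensorPower n H →L[ℂ] TensorPower n H) :=
  (tensorOpCMM n H).cont

/-- Any finite set of tuples sits in the box of its coordinate projections, where the sum factors.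
The upper bound suffices for everything below. -/
theorem tsum_prod_le_prod_tsum {ι : Type*} (f : Fin n → ι → ℝ≥0∞) :
    ∑' i : Fin n → ι, ∏ k, f k (i k) ≤ ∏ k, ∑' j, f k j := by
  classical
  rw [ENNReal.tsum_eq_iSup_sum]
  refine iSup_le fun s => ?_
  calc ∑ i ∈ s, ∏ k, f k (i k)
      ≤ ∑ i ∈ Fintype.piFinset fun k => s.image fun i => i k, ∏ k, f k (i k) := by
        refine Finset.sum_le_sum_of_subset fun i hi => ?_
        exact Fintype.mem_piFinset.2 fun k => Finset.mem_image_of_mem _ hi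
    _ = ∏ k, ∑ j ∈ s.image fun i => i k, f k j := (Finset.prod_univ_sum _ _).symm
    _ ≤ _ := Finset.prod_le_prod' fun k _ => ENNReal.sum_le_tsum _

/-- In the product basis the diagonal entries of a tensor product are products of diagonal entries.
-/
theorem traceNorm_tensorOp_le {A : Fin n → H →L[ℂ] H} (hA : ∀ k, 0 ≤ A k) :
    traceNorm (tensorOp A) ≤ ∏ k, traceNorm (A k) := by
  simp_rw [traceNorm_of_nonneg (onb H) (hA _)]
  rw [traceNorm_of_nonneg (tensorBasis (onb H)) (tensorOp_nonneg hA)]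
  refine le_trans (le_of_eq (tsum_congr fun i => ?_)) (tsum_prod_le_prod_tsum _)
  rw [tensorBasis_apply, tensorOp_tmul, inner_tmul,
    ← ENNReal.ofReal_prod_of_nonneg fun k _ => inner_re_nonneg (hA k) _]
  congr 1
  -- The diagonal entries of a positive operator are real, so the real part of their product is the
  -- product of their real parts.
  have h : ∀ k, inner ℂ (onb H (i k)) (A k (onb H (i k)))
      = (((inner ℂ (onb H (i k)) (A k (onb H (i k)))).re : ℝ) : ℂ) := fun k => by
    have := ((ContinuousLinearMap.nonneg_iff_isPositive _).1 (hA k)).inner_nonneg_right (onb H (i k))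
    exact Complex.eq_re_of_ofReal_le this
  rw [Finset.prod_congr rfl fun k _ => h k, ← Complex.ofReal_prod, Complex.ofReal_re]

/-- The tensor power of an average operator is the average of the tensor products. -/
theorem tensorOp_integral {X : Type*} [MeasurableSpace X] {P : Measure X} [IsProbabilityMeasure P]
    {F : X → H →L[ℂ] H} (hF : Integrable F P)
    (hFn : Integrable (fun x : Fin n → X => tensorOp fun i => F (x i)) (Measure.pi fun _ => P)) :
    tensorOp (fun _ : Fin n => ∫ x, F x ∂P)
      = ∫ x : Fin n → X, tensorOp (fun i => F (x i)) ∂(Measure.pi fun _ => P) := by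
  refine TensorPower.clm_ext fun v => TensorPower.ext_inner fun u => ?_
  rw [tensorOp_tmul, inner_tmul, inner_integral_apply hFn]
  simp only [tensorOp_tmul, inner_tmul]
  -- Matrix elements between elementary tensors are products of functions of separate letters, to
  -- which Fubini applies.
  rw [integral_fintype_prod_eq_prod (𝕜 := ℂ) (fun k x => inner ℂ (u k) (F x (v k)))]
  exact Finset.prod_congr rfl fun k _ => inner_integral_apply hF _ _

end TensorPower

/-! ### One-shot covering by a second moment argument -/

section Covering

variable {Z : Type*} [MeasurableSpace Z] {Q : Measure Z} [IsProbabilityMeasure Q]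

theorem measurePreserving_eval_pair {M : ℕ} {m l : Fin M} (h : m ≠ l) :
    MeasurePreserving (fun z : Fin M → Z => (z m, z l)) (Measure.pi fun _ => Q) (Q.prod Q) := by
  have hi := (ProbabilityTheory.iIndepFun_pi (μ := fun _ : Fin M => Q) (X := fun _ z => z)
    (fun _ => aemeasurable_id)).indepFun h
  have h1 := (ProbabilityTheory.indepFun_iff_map_prod_eq_prod_map_map
    (measurable_pi_apply m).aemeasurable (measurable_pi_apply l).aemeasurable).1 hi
  refine ⟨by fun_prop, h1.trans ?_⟩
  rw [(measurePreserving_eval (fun _ : Fin M => Q) m).map_eq,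
    (measurePreserving_eval (fun _ : Fin M => Q) l).map_eq]

variable {E : Type*} [NormedAddCommGroup E] [InnerProductSpace ℂ E] [CompleteSpace E]

theorem enorm_sq_eq_ofReal {E' : Type*} [NormedAddCommGroup E'] (x : E') :
    ‖x‖ₑ ^ 2 = ENNReal.ofReal (‖x‖ ^ 2) := by
  rw [← ofReal_norm, ENNReal.ofReal_pow (norm_nonneg _)]

theorem integrable_of_norm_le {E' : Type*} [NormedAddCommGroup E'] {u : Z → E'}
    (hu : StronglyMeasurable u) {C : ℝ} (hC : ∀ z, ‖u z‖ ≤ C) : Integrable u Q :=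
  Integrable.of_bound hu.aestronglyMeasurable C (Filter.Eventually.of_forall hC)

/-- Distinct codewords are independent and u is centred, so the cross terms of the variance vanish.
-/
theorem integral_inner_pi {u : Z → E} (hu : StronglyMeasurable u) {C : ℝ} (hC : ∀ z, ‖u z‖ ≤ C)
    (h0 : ∫ z, u z ∂Q = 0) {M : ℕ} {m l : Fin M} (h : m ≠ l) :
    ∫ z : Fin M → Z, inner ℂ (u (z m)) (u (z l)) ∂(Measure.pi fun _ => Q) = 0 := by
  have hm : StronglyMeasurable fun p : Z × Z => inner ℂ (u p.1) (u p.2) :=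
    (hu.comp_measurable measurable_fst).inner (hu.comp_measurable measurable_snd)
  have h1 := (measurePreserving_eval_pair (Q := Q) h).map_eq
  have h2 := integral_map (μ := Measure.pi fun _ : Fin M => Q)
    (φ := fun z : Fin M → Z => (z m, z l)) (by fun_prop)
    (hm.aestronglyMeasurable (μ := Measure.map (fun z : Fin M → Z => (z m, z l))
      (Measure.pi fun _ => Q)))
  refine h2.symm.trans ?_
  rw [h1, integral_prod]
  · have hin : ∀ x, ∫ y, inner ℂ (u x) (u y) ∂Q = 0 := fun x => by
      rw [integral_inner (integrable_of_norm_le hu hC), h0, inner_zero_right]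
    simp [hin]
  · refine integrable_of_norm_le (C := C * C) hm fun p => ?_
    exact (norm_inner_le_norm _ _).trans
      (mul_le_mul (hC _) (hC _) (norm_nonneg _) ((norm_nonneg _).trans (hC p.1)))

theorem integral_norm_sum_sq_pi {u : Z → E} (hu : StronglyMeasurable u) {C : ℝ}
    (hC : ∀ z, ‖u z‖ ≤ C) (h0 : ∫ z, u z ∂Q = 0) (M : ℕ) :
    ∫ z : Fin M → Z, ‖∑ m, u (z m)‖ ^ 2 ∂(Measure.pi fun _ => Q) = M * ∫ z, ‖u z‖ ^ 2 ∂Q := by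
  have hint : ∀ m l : Fin M, Integrable (fun z : Fin M → Z => inner ℂ (u (z m)) (u (z l)))
      (Measure.pi fun _ => Q) := fun m l =>
    integrable_of_norm_le (C := C * C)
      ((hu.comp_measurable (measurable_pi_apply m)).inner (hu.comp_measurable (measurable_pi_apply l)))
      fun p => (norm_inner_le_norm _ _).trans
        (mul_le_mul (hC _) (hC _) (norm_nonneg _) ((norm_nonneg _).trans (hC (p m))))
  have hd : ∀ m : Fin M, ∫ z : Fin M → Z, inner ℂ (u (z m)) (u (z m)) ∂(Measure.pi fun _ => Q)
      = ((∫ z, ‖u z‖ ^ 2 ∂Q : ℝ) : ℂ) := fun m => by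
    simp only [inner_self_eq_norm_sq_to_K]
    have h2 := integral_map (μ := Measure.pi fun _ : Fin M => Q)
      (measurable_pi_apply m).aemeasurable
      ((hu.norm.pow 2).aestronglyMeasurable (μ := Measure.map (Function.eval m)
        (Measure.pi fun _ => Q)))
    rw [(measurePreserving_eval (fun _ : Fin M => Q) m).map_eq] at h2
    have h3 : ∀ z : Fin M → Z, ((‖u (z m)‖ : ℂ) ^ 2) = ((‖u (z m)‖ ^ 2 : ℝ) : ℂ) := fun z => by
      push_cast; rfl
    refine (integral_congr_ae (Filter.Eventually.of_forall h3)).trans ?_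
    rw [integral_complex_ofReal]
    exact congrArg _ h2.symm
  have key : ∫ z : Fin M → Z, inner ℂ (∑ m, u (z m)) (∑ m, u (z m)) ∂(Measure.pi fun _ => Q)
      = ((M * ∫ z, ‖u z‖ ^ 2 ∂Q : ℝ) : ℂ) := by
    simp only [sum_inner, inner_sum]
    rw [integral_finsetSum _ fun m _ => integrable_finsetSum _ fun l _ => hint l m]
    have : ∀ m : Fin M, ∫ z : Fin M → Z, ∑ l, inner ℂ (u (z l)) (u (z m)) ∂(Measure.pi fun _ => Q)
        = ((∫ z, ‖u z‖ ^ 2 ∂Q : ℝ) : ℂ) := fun m => by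
      rw [integral_finsetSum _ fun l _ => hint l m, Finset.sum_eq_single m, hd]
      · exact fun l _ hl => integral_inner_pi hu hC h0 hl
      · simp
    simp [this]
  have h4 : ∀ z : Fin M → Z, inner ℂ (∑ m, u (z m)) (∑ m, u (z m))
      = ((‖∑ m, u (z m)‖ ^ 2 : ℝ) : ℂ) := fun z => by
    rw [inner_self_eq_norm_sq_to_K]; push_cast; rfl
  simp only [h4] at key
  rw [integral_complex_ofReal] at key
  exact_mod_cast key

/-- The variance of a mean of M independent copies is 1/M of a single variance, which is at most the
second moment. Discarding the centre keeps the bound free of the average. -/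
theorem lintegral_enorm_mean_sub_sq_le {g : Z → E} (hg : StronglyMeasurable g) {C : ℝ}
    (hC : ∀ z, ‖g z‖ ≤ C) {M : ℕ} (hM : 0 < M) :
    ∫⁻ z : Fin M → Z, ‖(1 / (M : ℂ)) • ∑ m, g (z m) - ∫ z, g z ∂Q‖ₑ ^ 2 ∂(Measure.pi fun _ => Q)
      ≤ (M : ℝ≥0∞)⁻¹ * ∫⁻ z, ‖g z‖ₑ ^ 2 ∂Q := by
  have hMc : (M : ℂ) ≠ 0 := by exact_mod_cast hM.ne'
  have hMr : (0 : ℝ) < M := by exact_mod_cast hM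
  set b := ∫ z, g z ∂Q with hb
  have hgi : Integrable g Q := integrable_of_norm_le hg hC
  have hu : StronglyMeasurable fun z => g z - b := hg.sub stronglyMeasurable_const
  have huC : ∀ z, ‖g z - b‖ ≤ C + ‖b‖ := fun z => (norm_sub_le _ _).trans (by gcongr; exact hC z)
  have hu0 : ∫ z, (g z - b) ∂Q = 0 := by
    rw [integral_sub hgi (integrable_const _)]; simp [hb]
  have hv := integral_norm_sum_sq_pi hu huC hu0 M
  have hmean : ∀ z : Fin M → Z, (1 / (M : ℂ)) • ∑ m, g (z m) - b
      = (1 / (M : ℂ)) • ∑ m, (g (z m) - b) := fun z => by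
    rw [Finset.sum_sub_distrib, smul_sub]
    congr 1
    rw [Finset.sum_const, Finset.card_univ, Fintype.card_fin, ← Nat.cast_smul_eq_nsmul ℂ, smul_smul,
      one_div, inv_mul_cancel₀ hMc, one_smul]
  have hnorm : ∀ z : Fin M → Z, ‖(1 / (M : ℂ)) • ∑ m, g (z m) - b‖ ^ 2
      = (M : ℝ)⁻¹ ^ 2 * ‖∑ m, (g (z m) - b)‖ ^ 2 := fun z => by
    rw [hmean, norm_smul, mul_pow]; simp
  have hum : StronglyMeasurable fun z : Fin M → Z => ∑ m, (g (z m) - b) :=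
    Finset.stronglyMeasurable_fun_sum _ fun m _ => hu.comp_measurable (measurable_pi_apply m)
  have hui : Integrable (fun z : Fin M → Z => (M : ℝ)⁻¹ ^ 2 * ‖∑ m, (g (z m) - b)‖ ^ 2)
      (Measure.pi fun _ => Q) := by
    refine Integrable.const_mul ?_ _
    refine integrable_of_norm_le (C := (M * (C + ‖b‖)) ^ 2) (hum.norm.pow 2) fun z => ?_
    rw [norm_pow, norm_norm]
    gcongr
    refine (norm_sum_le_of_le _ fun m _ => huC (z m)).trans_eq ?_
    simp only [Finset.sum_const, Finset.card_univ, Fintype.card_fin, nsmul_eq_mul]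
  have hgi2 : Integrable (fun z => ‖g z‖ ^ 2) Q := by
    refine integrable_of_norm_le (C := C ^ 2) (hg.norm.pow 2) fun z => ?_
    rw [norm_pow, norm_norm]
    gcongr
    exact hC z
  have hvar : ∫ z, ‖g z - b‖ ^ 2 ∂Q ≤ ∫ z, ‖g z‖ ^ 2 ∂Q := by
    have hin : Integrable (fun z => inner ℂ b (g z)) Q := (innerSL ℂ b).integrable_comp hgi
    have e1 : ∀ z, ‖g z - b‖ ^ 2 = (‖g z‖ ^ 2 + ‖b‖ ^ 2) - 2 * (inner ℂ b (g z)).re := fun z => by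
      rw [@norm_sub_sq ℂ, ← inner_conj_symm]
      simp only [RCLike.re_to_complex, Complex.conj_re]
      ring
    have e2 : ∫ z, (inner ℂ b (g z)).re ∂Q = ‖b‖ ^ 2 := by
      have e3 := integral_re hin
      simp only [RCLike.re_to_complex] at e3
      rw [e3, integral_inner hgi, ← hb]
      exact inner_self_eq_norm_sq (𝕜 := ℂ) b
    have hre : Integrable (fun z => 2 * (inner ℂ b (g z)).re) Q := hin.re.const_mul 2
    have hadd : Integrable (fun z => ‖g z‖ ^ 2 + ‖b‖ ^ 2) Q := hgi2.add (integrable_const _)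
    simp only [e1]
    rw [integral_sub hadd hre,
      integral_add hgi2 (integrable_const _), integral_const_mul, e2]
    simp only [integral_const, probReal_univ, one_smul]
    nlinarith [sq_nonneg ‖b‖]
  simp only [enorm_sq_eq_ofReal, hnorm]
  rw [← ofReal_integral_eq_lintegral_ofReal hui (Filter.Eventually.of_forall fun z => by positivity),
    ← ofReal_integral_eq_lintegral_ofReal hgi2 (Filter.Eventually.of_forall fun z => by positivity),
    integral_const_mul, hv, ← ENNReal.ofReal_natCast, ← ENNReal.ofReal_inv_of_pos hMr,
    ← ENNReal.ofReal_mul (by positivity)]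
  refine ENNReal.ofReal_le_ofReal ?_
  calc (M : ℝ)⁻¹ ^ 2 * (M * ∫ z, ‖g z - b‖ ^ 2 ∂Q) = (M : ℝ)⁻¹ * ∫ z, ‖g z - b‖ ^ 2 ∂Q := by
        field_simp
    _ ≤ _ := by gcongr

variable {K : Type*} [NormedAddCommGroup K] [InnerProductSpace ℂ K] [CompleteSpace K]
  [Countable (BasisIndex K)]

/-- The squared Hilbert–Schmidt norm is a sum of squared Hilbert space norms over basis vectors, so
the vector variance bound applies column by column. The trace norm has no such orthogonality. -/
theorem lintegral_hsSq_mean_sub_le {G : Z → K →L[ℂ] K} (hG : StronglyMeasurable G)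
    (hG1 : ∀ z, ‖G z‖ ≤ 1) {M : ℕ} (hM : 0 < M) :
    ∫⁻ z : Fin M → Z, hsSq ((1 / (M : ℂ)) • ∑ m, G (z m) - ∫ z, G z ∂Q) ∂(Measure.pi fun _ => Q)
      ≤ (M : ℝ≥0∞)⁻¹ * ∫⁻ z, hsSq (G z) ∂Q := by
  have hGv : ∀ v : K, StronglyMeasurable fun z => G z v := fun v =>
    (ContinuousLinearMap.apply ℂ K v).continuous.comp_stronglyMeasurable hG
  have hGi : Integrable G Q := integrable_of_norm_le hG hG1
  have hsum : ∀ v : K, StronglyMeasurable fun z : Fin M → Z =>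
      (1 / (M : ℂ)) • ∑ m, G (z m) v - ∫ z, G z v ∂Q := fun v =>
    ((Finset.stronglyMeasurable_fun_sum _ fun m _ =>
      (hGv v).comp_measurable (measurable_pi_apply m)).const_smul _).sub stronglyMeasurable_const
  have happ : ∀ (v : K) (z : Fin M → Z), ((1 / (M : ℂ)) • ∑ m, G (z m) - ∫ z, G z ∂Q) v
      = (1 / (M : ℂ)) • ∑ m, G (z m) v - ∫ z, G z v ∂Q := fun v z => by
    rw [sub_apply, smul_apply, sum_apply, ContinuousLinearMap.integral_apply hGi]
  simp only [hsSq, happ]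
  rw [lintegral_tsum fun i => ((hsum _).enorm.pow_const 2).aemeasurable,
    lintegral_tsum fun i => ((hGv _).enorm.pow_const 2).aemeasurable, ← ENNReal.tsum_mul_left]
  refine ENNReal.tsum_le_tsum fun i => ?_
  refine lintegral_enorm_mean_sub_sq_le (hGv _) (C := 1) (fun z => ?_) hM
  refine (norm_apply_le_of_norm_le_one (hG1 z) _).trans_eq ((onb K).orthonormal.1 i)

omit [IsProbabilityMeasure Q] in
-- On positive operators the trace norm is the trace, hence additive, and averaging loses nothing.
theorem lintegral_traceNorm_of_nonneg {F : Z → K →L[ℂ] K} (hF : Integrable F Q)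
    (h0 : ∀ z, 0 ≤ F z) : ∫⁻ z, traceNorm (F z) ∂Q = traceNorm (∫ z, F z ∂Q) := by
  have hin : ∀ i, Integrable (fun z => inner ℂ (onb K i) (F z (onb K i))) Q := fun i =>
    (innerSL ℂ (onb K i)).integrable_comp
      ((ContinuousLinearMap.apply ℂ K (onb K i)).integrable_comp hF)
  have hre : ∀ i, Integrable (fun z => (inner ℂ (onb K i) (F z (onb K i))).re) Q := fun i => (hin i).re
  rw [traceNorm_of_nonneg (onb K) (integral_nonneg h0)]
  simp_rw [traceNorm_of_nonneg (onb K) (h0 _)]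
  rw [lintegral_tsum fun i => (hre i).1.aemeasurable.ennreal_ofReal]
  refine tsum_congr fun i => ?_
  have h1 := integral_re (hin i)
  simp only [RCLike.re_to_complex] at h1
  rw [inner_integral_apply hF, ← h1, ofReal_integral_eq_lintegral_ofReal (hre i)
    (Filter.Eventually.of_forall fun z => inner_re_nonneg (h0 z) _)]

omit [Countable (BasisIndex K)] in
theorem traceNorm_sum_le {ι : Type*} (s : Finset ι) (f : ι → K →L[ℂ] K) :
    traceNorm (∑ i ∈ s, f i) ≤ ∑ i ∈ s, traceNorm (f i) := by
  classical
  induction s using Finset.induction_on with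
  | empty => simp [traceNorm_zero]
  | insert i s hi ih =>
    rw [Finset.sum_insert hi, Finset.sum_insert hi]
    exact (traceNorm_add_le _ _).trans (by gcongr)

/-- One-shot covering: if `F` is approximated by `G B`, then the empirical mean of `F` is close to
its average in trace norm. -/
theorem lintegral_traceNorm_mean_sub_le {F G : Z → K →L[ℂ] K} (hF : StronglyMeasurable F)
    (hG : StronglyMeasurable G) (hF1 : ∀ z, ‖F z‖ ≤ 1) (hG1 : ∀ z, ‖G z‖ ≤ 1) (B : K →L[ℂ] K)
    {c : ℝ} (hc : 0 < c) {M : ℕ} (hM : 0 < M) :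
    ∫⁻ z : Fin M → Z, traceNorm ((1 / (M : ℂ)) • ∑ m, F (z m) - ∫ z, F z ∂Q)
        ∂(Measure.pi fun _ => Q)
      ≤ 2 * ∫⁻ z, traceNorm (F z - G z * B) ∂Q
        + 2⁻¹ * (ENNReal.ofReal c * ((M : ℝ≥0∞)⁻¹ * ∫⁻ z, hsSq (G z) ∂Q)
          + ENNReal.ofReal c⁻¹ * hsSq B) := by
  have hMc : (M : ℝ≥0∞) ≠ 0 := by exact_mod_cast hM.ne'
  have hFi : Integrable F Q := integrable_of_norm_le hF hF1
  have hGi : Integrable G Q := integrable_of_norm_le hG hG1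
  have hGBi : Integrable (fun z => G z * B) Q :=
    ((ContinuousLinearMap.mul ℂ (K →L[ℂ] K)).flip B).integrable_comp hGi
  have hGB : ∫ z, G z * B ∂Q = (∫ z, G z ∂Q) * B :=
    ((ContinuousLinearMap.mul ℂ (K →L[ℂ] K)).flip B).integral_comp_comm hGi
  have hR : StronglyMeasurable fun z => F z - G z * B :=
    hF.sub (((ContinuousLinearMap.mul ℂ (K →L[ℂ] K)).flip B).continuous.comp_stronglyMeasurable hG)
  have hRm := measurable_traceNorm_of_stronglyMeasurable hR
  set r := ∫⁻ z, traceNorm (F z - G z * B) ∂Q with hr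
  have hbias : traceNorm (∫ z, (F z - G z * B) ∂Q) ≤ r := traceNorm_integral_le (hFi.sub hGBi)
  have hpt : ∀ z : Fin M → Z, traceNorm ((1 / (M : ℂ)) • ∑ m, F (z m) - ∫ z, F z ∂Q)
      ≤ (M : ℝ≥0∞)⁻¹ * ∑ m, traceNorm (F (z m) - G (z m) * B)
        + (2⁻¹ * (ENNReal.ofReal c * hsSq ((1 / (M : ℂ)) • ∑ m, G (z m) - ∫ z, G z ∂Q)
          + ENNReal.ofReal c⁻¹ * hsSq B) + r) := fun z => by
    -- The centred mean of F is the centred mean of G times B, plus the empirical and the expected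
    -- approximation error. Each error costs r, whence the factor 2.
    have hdec : (1 / (M : ℂ)) • ∑ m, F (z m) - ∫ z, F z ∂Q
        = (1 / (M : ℂ)) • ∑ m, (F (z m) - G (z m) * B)
          + (((1 / (M : ℂ)) • ∑ m, G (z m) - ∫ z, G z ∂Q) * B + -∫ z, (F z - G z * B) ∂Q) := by
      rw [integral_sub hFi hGBi, hGB, Finset.sum_sub_distrib, sub_mul, smul_sub, smul_mul_assoc,
        Finset.sum_mul]
      abel
    rw [hdec]
    refine (traceNorm_add_le _ _).trans (add_le_add ?_ ((traceNorm_add_le _ _).trans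
      (add_le_add (traceNorm_mul_le_hsSq _ _ hc) (by rwa [traceNorm_neg]))))
    rw [traceNorm_smul]
    have hn : ‖(1 / (M : ℂ))‖ₑ = (M : ℝ≥0∞)⁻¹ := by
      rw [← ofReal_norm]
      simp only [one_div, norm_inv, RCLike.norm_natCast]
      rw [ENNReal.ofReal_inv_of_pos (by exact_mod_cast hM), ENNReal.ofReal_natCast]
    rw [hn]
    gcongr
    exact traceNorm_sum_le _ _
  refine (lintegral_mono hpt).trans ?_
  have hev : ∀ m : Fin M, ∫⁻ z : Fin M → Z, traceNorm (F (z m) - G (z m) * B)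
      ∂(Measure.pi fun _ => Q) = r := fun m =>
    (measurePreserving_eval (fun _ : Fin M => Q) m).lintegral_comp hRm
  have hGm : StronglyMeasurable fun z : Fin M → Z =>
      (1 / (M : ℂ)) • ∑ m, G (z m) - ∫ z, G z ∂Q := by
    have h : StronglyMeasurable fun z : Fin M → Z => ∑ m, G (z m) :=
      Finset.stronglyMeasurable_fun_sum _ fun m _ => hG.comp_measurable (measurable_pi_apply m)
    exact (h.const_smul (1 / (M : ℂ))).sub stronglyMeasurable_const
  have hhs := measurable_hsSq_of_stronglyMeasurable hGm
  have hRe : ∀ m : Fin M, Measurable fun z : Fin M → Z => traceNorm (F (z m) - G (z m) * B) :=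
    fun m => hRm.comp (measurable_pi_apply m)
  have hRs : Measurable fun z : Fin M → Z => ∑ m, traceNorm (F (z m) - G (z m) * B) :=
    Finset.measurable_fun_sum _ fun m _ => hRe m
  rw [lintegral_add_left (hRs.const_mul _), lintegral_const_mul _ hRs,
    lintegral_finsetSum _ fun m _ => hRe m,
    lintegral_add_right _ measurable_const, lintegral_const_mul _ (by fun_prop),
    lintegral_add_right _ measurable_const, lintegral_const_mul _ hhs]
  simp only [hev, lintegral_const, measure_univ, mul_one, Finset.sum_const, Finset.card_univ,
    Fintype.card_fin, nsmul_eq_mul]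
  rw [ENNReal.inv_mul_cancel_left hMc (by simp)]
  calc r + (2⁻¹ * (ENNReal.ofReal c * _ + ENNReal.ofReal c⁻¹ * hsSq B) + r)
      ≤ r + (2⁻¹ * (ENNReal.ofReal c * ((M : ℝ≥0∞)⁻¹ * ∫⁻ z, hsSq (G z) ∂Q)
          + ENNReal.ofReal c⁻¹ * hsSq B) + r) := by
        gcongr
        exact lintegral_hsSq_mean_sub_le hG hG1 hM
    _ = _ := by ring

/-- A form of the gentle measurement argument. The operator B is chosen for the average alone; since
tr((1 - B) F(z) (1 - B)) is linear in F(z), its mean is the same expression at the averaged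
operator. -/
theorem lintegral_traceNorm_sub_mul_le {F G : Z → K →L[ℂ] K} (hF : StronglyMeasurable F)
    (hG : StronglyMeasurable G) (hF0 : ∀ z, 0 ≤ F z) (hFt : ∀ z, traceNorm (F z) ≤ 1)
    (hGF : ∀ z, G z ≤ F z) {B : K →L[ℂ] K} (hB : IsSelfAdjoint B)
    (hB1 : ‖B‖ ≤ 1) {c : ℝ} (hc : 0 < c) :
    ∫⁻ z, traceNorm (F z - G z * B) ∂Q
      ≤ ∫⁻ z, traceNorm (F z - G z) ∂Q
        + 2⁻¹ * (ENNReal.ofReal c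
          + ENNReal.ofReal c⁻¹ * traceNorm ((1 - B) * (∫ z, F z ∂Q) * (1 - B))) := by
  have hFi : Integrable F Q :=
    integrable_of_norm_le hF fun z => norm_le_one_of_traceNorm_le_one (hFt z)
  have hs : star (1 - B) = 1 - B := by rw [star_sub, star_one, hB.star_eq]
  let L : (K →L[ℂ] K) →L[ℂ] (K →L[ℂ] K) :=
    ((ContinuousLinearMap.mul ℂ (K →L[ℂ] K)).flip (1 - B)).comp
      (ContinuousLinearMap.mul ℂ (K →L[ℂ] K) (1 - B))
  have hL : ∀ A, L A = (1 - B) * A * (1 - B) := fun A => rfl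
  have hpos : ∀ z, 0 ≤ L (F z) := fun z => by
    have h := star_left_conjugate_nonneg (hF0 z) (1 - B)
    rwa [hs] at h
  have hint : ∫⁻ z, traceNorm (L (F z)) ∂Q = traceNorm ((1 - B) * (∫ z, F z ∂Q) * (1 - B)) := by
    rw [lintegral_traceNorm_of_nonneg (L.integrable_comp hFi) hpos, L.integral_comp_comm hFi, hL]
  have hpt : ∀ z, traceNorm (F z - G z * B) ≤ traceNorm (F z - G z)
      + 2⁻¹ * (ENNReal.ofReal c + ENNReal.ofReal c⁻¹ * traceNorm (L (F z))) := fun z => by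
    -- The first summand is positive times a contraction. The second is √F · (√F (1 - B)), with
    -- ‖√F‖₂² = tr F ≤ 1.
    have hdec : F z - G z * B = (F z - G z) * B + F z * (1 - B) := by noncomm_ring
    rw [hdec]
    refine (traceNorm_add_le _ _).trans
      (add_le_add (traceNorm_mul_le_of_nonneg (sub_nonneg.2 (hGF z)) hB1) ?_)
    set S := CFC.sqrt (F z) with hS
    have hsS : star S = S := (CFC.sqrt_nonneg (F z)).isSelfAdjoint
    have hSS : S * S = F z := CFC.sqrt_mul_sqrt_self (F z) (hF0 z)
    have h1 : hsSq S ≤ 1 := by rw [← traceNorm_star_mul_self, hsS, hSS]; exact hFt z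
    have h2 : hsSq (S * (1 - B)) = traceNorm (L (F z)) := by
      rw [← traceNorm_star_mul_self, star_mul, hsS, hs, hL, ← hSS]
      simp only [mul_assoc]
    calc traceNorm (F z * (1 - B)) = traceNorm (S * (S * (1 - B))) := by rw [← hSS, mul_assoc]
      _ ≤ 2⁻¹ * (ENNReal.ofReal c * hsSq S + ENNReal.ofReal c⁻¹ * hsSq (S * (1 - B))) :=
        traceNorm_mul_le_hsSq _ _ hc
      _ ≤ _ := by
        rw [h2]
        gcongr
        exact mul_le_of_le_one_right zero_le h1
  refine (lintegral_mono hpt).trans_eq ?_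
  have hm1 : Measurable fun z => traceNorm (F z - G z) :=
    measurable_traceNorm_of_stronglyMeasurable (hF.sub hG)
  have hm2 := measurable_traceNorm_of_stronglyMeasurable (L.continuous.comp_stronglyMeasurable hF)
  rw [lintegral_add_left hm1, lintegral_const_mul _ (by fun_prop),
    lintegral_add_left measurable_const, lintegral_const_mul _ hm2, hint]
  simp

end Covering

/-! ### Spectral truncations of a positive operator -/

section Truncation

variable {K : Type*} [NormedAddCommGroup K] [InnerProductSpace ℂ K] [CompleteSpace K]

theorem cfc_mono_of_nonneg {A : K →L[ℂ] K} (hA : 0 ≤ A) {f g : ℝ → ℝ} (hf : Continuous f)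
    (hg : Continuous g) (h : ∀ t, 0 ≤ t → f t ≤ g t) : cfc f A ≤ cfc g A :=
  cfc_mono (fun t ht => h t (spectrum_nonneg_of_nonneg hA ht)) hf.continuousOn hg.continuousOn

theorem cfc_nonneg_of_nonneg {A : K →L[ℂ] K} (hA : 0 ≤ A) {f : ℝ → ℝ}
    (h : ∀ t, 0 ≤ t → 0 ≤ f t) : 0 ≤ cfc f A :=
  cfc_nonneg fun t ht => h t (spectrum_nonneg_of_nonneg hA ht)

theorem traceNorm_cfc_mono {A : K →L[ℂ] K} (hA : 0 ≤ A) {f g : ℝ → ℝ} (hf : Continuous f)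
    (hg : Continuous g) (h0 : ∀ t, 0 ≤ t → 0 ≤ f t) (h : ∀ t, 0 ≤ t → f t ≤ g t) :
    traceNorm (cfc f A) ≤ traceNorm (cfc g A) :=
  traceNorm_mono (cfc_nonneg_of_nonneg hA h0) (cfc_mono_of_nonneg hA hf hg h)

theorem cfc_min_le {A : K →L[ℂ] K} (hA : 0 ≤ A) (m : ℝ) :
    cfc (fun t : ℝ => min t m) A ≤ A := by
  conv_rhs => rw [← cfc_id' ℝ A]
  exact cfc_mono_of_nonneg hA (by fun_prop) (by fun_prop) fun t _ => min_le_left _ _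

theorem cfc_min_nonneg {A : K →L[ℂ] K} (hA : 0 ≤ A) {m : ℝ} (hm : 0 ≤ m) :
    0 ≤ cfc (fun t : ℝ => min t m) A :=
  cfc_nonneg_of_nonneg hA fun _ ht => le_min ht hm

/-- The squared norm is tr f(A)² ≤ c tr A. It serves both cut-offs: min(t, μ) with c = μ, and min(1,
t/μ) with c = 1/μ. -/
theorem hsSq_cfc_le {A : K →L[ℂ] K} (hA : 0 ≤ A) (hAt : traceNorm A ≤ 1) {f : ℝ → ℝ}
    (hf : Continuous f) {c : ℝ} (hc : 0 ≤ c) (h : ∀ t, 0 ≤ t → f t * f t ≤ c * t) :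
    hsSq (cfc f A) ≤ ENNReal.ofReal c := by
  have hs : IsSelfAdjoint (cfc f A) := cfc_predicate _ _
  rw [← traceNorm_star_mul_self, hs.star_eq, ← cfc_mul f f A hf.continuousOn hf.continuousOn]
  refine (traceNorm_cfc_mono hA (hf.mul hf) (g := fun t => c * t) (by fun_prop)
    (fun t _ => mul_self_nonneg _) h).trans ?_
  rw [cfc_const_mul_id c A, traceNorm_real_smul hc]
  exact mul_le_of_le_one_right zero_le hAt

/-- The part of `T ^ (j + 1)` above the level `ν ^ (j + 1)` is controlled by `T ^ (j + 2)`. -/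
theorem traceNorm_sub_cfc_min_le {T : K →L[ℂ] K} (hT : 0 ≤ T) (j : ℕ) {ν : ℝ} (hν : 0 < ν) :
    traceNorm (T ^ (j + 1) - cfc (fun t : ℝ => min t (ν ^ (j + 1))) (T ^ (j + 1)))
      ≤ ENNReal.ofReal ν⁻¹ * traceNorm (T ^ (j + 2)) := by
  have hTs : IsSelfAdjoint T := hT.isSelfAdjoint
  have h1 : T ^ (j + 1) - cfc (fun t : ℝ => min t (ν ^ (j + 1))) (T ^ (j + 1))
      = cfc (fun t : ℝ => t ^ (j + 1) - min (t ^ (j + 1)) (ν ^ (j + 1))) T := by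
    rw [cfc_sub (fun t : ℝ => t ^ (j + 1)) (fun t : ℝ => min (t ^ (j + 1)) (ν ^ (j + 1))) T
      (by fun_prop) (by fun_prop), cfc_pow_id T (j + 1),
      cfc_comp_pow (fun t : ℝ => min t (ν ^ (j + 1))) (j + 1) T (by fun_prop)]
  have h2 : ν⁻¹ • T ^ (j + 2) = cfc (fun t : ℝ => ν⁻¹ * t ^ (j + 2)) T := by
    rw [cfc_const_mul _ (fun t : ℝ => t ^ (j + 2)) T (by fun_prop), cfc_pow_id T (j + 2)]
  rw [h1, ← traceNorm_real_smul (by positivity), h2]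
  refine traceNorm_cfc_mono hT (by fun_prop) (by fun_prop)
    (fun t _ => sub_nonneg.2 (min_le_left _ _)) fun t ht => ?_
  -- Chernoff's trick: nothing remains below ν, and above ν the factor t/ν ≥ 1 pays for one more
  -- power.
  rcases le_total t ν with h | h
  · rw [min_eq_left (pow_le_pow_left₀ ht h _), sub_self]
    positivity
  · have h3 : t ^ (j + 1) ≤ ν⁻¹ * t ^ (j + 2) := by
      rw [← div_eq_inv_mul, le_div_iff₀ hν, pow_succ t (j + 1)]
      gcongr
    have h4 : 0 ≤ min (t ^ (j + 1)) (ν ^ (j + 1)) := by positivity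
    linarith

/-- The part of `T ^ (j + 1)` below the level `ν ^ (j + 1)` is controlled by `T ^ j`. -/
theorem traceNorm_conj_one_sub_cfc_le {T : K →L[ℂ] K} (hT : 0 ≤ T) (j : ℕ) {ν : ℝ} (hν : 0 < ν) :
    traceNorm ((1 - cfc (fun t : ℝ => min 1 (t / ν ^ (j + 1))) (T ^ (j + 1))) * T ^ (j + 1)
        * (1 - cfc (fun t : ℝ => min 1 (t / ν ^ (j + 1))) (T ^ (j + 1))))
      ≤ ENNReal.ofReal ν * traceNorm (T ^ j) := by
  have hTs : IsSelfAdjoint T := hT.isSelfAdjoint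
  have h1 : 1 - cfc (fun t : ℝ => min 1 (t / ν ^ (j + 1))) (T ^ (j + 1))
      = cfc (fun t : ℝ => 1 - min 1 (t ^ (j + 1) / ν ^ (j + 1))) T := by
    rw [cfc_sub (fun _ : ℝ => 1) (fun t : ℝ => min 1 (t ^ (j + 1) / ν ^ (j + 1))) T
      (by fun_prop) (by fun_prop), cfc_const_one ℝ T,
      cfc_comp_pow (fun t : ℝ => min 1 (t / ν ^ (j + 1))) (j + 1) T (by fun_prop)]
  have h2 : ν • T ^ j = cfc (fun t : ℝ => ν * t ^ j) T := by
    rw [cfc_const_mul _ (fun t : ℝ => t ^ j) T (by fun_prop), cfc_pow_id T j]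
  have h3 : cfc (fun t : ℝ => 1 - min 1 (t ^ (j + 1) / ν ^ (j + 1))) T * T ^ (j + 1)
      * cfc (fun t : ℝ => 1 - min 1 (t ^ (j + 1) / ν ^ (j + 1))) T
      = cfc (fun t : ℝ => (1 - min 1 (t ^ (j + 1) / ν ^ (j + 1))) * t ^ (j + 1)
        * (1 - min 1 (t ^ (j + 1) / ν ^ (j + 1)))) T := by
    rw [cfc_mul (fun t : ℝ => (1 - min 1 (t ^ (j + 1) / ν ^ (j + 1))) * t ^ (j + 1))
      (fun t : ℝ => 1 - min 1 (t ^ (j + 1) / ν ^ (j + 1))) T (by fun_prop) (by fun_prop),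
      cfc_mul (fun t : ℝ => 1 - min 1 (t ^ (j + 1) / ν ^ (j + 1))) (fun t : ℝ => t ^ (j + 1)) T
        (by fun_prop) (by fun_prop), cfc_pow_id T (j + 1)]
  rw [h1, h3, ← traceNorm_real_smul hν.le, h2]
  have hb0 : ∀ t : ℝ, 0 ≤ 1 - min 1 (t ^ (j + 1) / ν ^ (j + 1)) := fun t =>
    sub_nonneg.2 (min_le_left _ _)
  refine traceNorm_cfc_mono hT (by fun_prop) (by fun_prop)
    (fun t ht => mul_nonneg (mul_nonneg (hb0 t) (by positivity)) (hb0 t)) fun t ht => ?_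
  have hb1 : 1 - min 1 (t ^ (j + 1) / ν ^ (j + 1)) ≤ 1 := by
    have : 0 ≤ min 1 (t ^ (j + 1) / ν ^ (j + 1)) := by positivity
    linarith
  -- Below ν one power of t is traded for ν; above ν the factors 1 - min vanish.
  rcases le_total t ν with h | h
  · calc _ ≤ 1 * t ^ (j + 1) * 1 := by
          have := hb0 t
          gcongr
      _ ≤ ν * t ^ j := by
          rw [one_mul, mul_one, pow_succ, mul_comm]
          gcongr
  · have h4 : 1 ≤ t ^ (j + 1) / ν ^ (j + 1) := (one_le_div (by positivity)).2 (by gcongr)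
    rw [min_eq_left h4]
    simp only [sub_self, zero_mul, mul_zero]
    positivity

end Truncation

/-! ### Fractional moments of tensor products -/

section Powers

variable {H : Type*} [NormedAddCommGroup H] [InnerProductSpace ℂ H] [CompleteSpace H]

theorem rpow_inv_natCast_pow {A : H →L[ℂ] H} (hA : 0 ≤ A) (k l : ℕ) :
    (A ^ ((k : ℝ)⁻¹)) ^ l = A ^ ((l : ℝ) / k) := by
  rw [← CFC.rpow_natCast _ l CFC.rpow_nonneg,
    CFC.rpow_rpow_of_exponent_nonneg A _ _ (by positivity) (by positivity)]
  congr 1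
  rw [inv_mul_eq_div]

variable {n : ℕ}

/-- The root of a tensor product of positive operators. -/
theorem tensorOp_root_pow {A : Fin n → H →L[ℂ] H} (hA : ∀ i, 0 ≤ A i) (k l : ℕ) :
    tensorOp (fun i => A i ^ ((k : ℝ)⁻¹)) ^ l = tensorOp fun i => A i ^ ((l : ℝ) / k) := by
  rw [tensorOp_pow]
  congr 1
  funext i
  exact rpow_inv_natCast_pow (hA i) k l

theorem traceNorm_tensorOp_root_pow_le {A : Fin n → H →L[ℂ] H} (hA : ∀ i, 0 ≤ A i) (k l : ℕ) :
    traceNorm (tensorOp (fun i => A i ^ ((k : ℝ)⁻¹)) ^ l)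
      ≤ ∏ i, traceNorm (A i ^ ((l : ℝ) / k)) := by
  rw [tensorOp_root_pow hA]
  exact traceNorm_tensorOp_le fun i => CFC.rpow_nonneg

theorem tensorOp_root_pow_self {A : Fin n → H →L[ℂ] H} (hA : ∀ i, 0 ≤ A i) {k : ℕ} (hk : k ≠ 0) :
    tensorOp (fun i => A i ^ ((k : ℝ)⁻¹)) ^ k = tensorOp A := by
  rw [tensorOp_root_pow hA]
  congr 1
  funext i
  rw [div_self (by exact_mod_cast hk), CFC.rpow_one (A i) (hA i)]

/-- The bound for a single operator is applied to T = ⊗ Aᵢ^(1/(j+1)): its power j + 1 is ⊗ Aᵢ, and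
its power j + 2 gives moments of order 1 + 1/(j+1). No real power of an operator on H^{⊗n} is
needed. -/
theorem traceNorm_tensorOp_sub_cfc_min_le {A : Fin n → H →L[ℂ] H} (hA : ∀ i, 0 ≤ A i) (j : ℕ)
    {ν : ℝ} (hν : 0 < ν) :
    traceNorm (tensorOp A - cfc (fun t : ℝ => min t (ν ^ (j + 1))) (tensorOp A))
      ≤ ENNReal.ofReal ν⁻¹ * ∏ i, traceNorm (A i ^ (((j + 2 : ℕ) : ℝ) / (j + 1 : ℕ))) := by
  have h := traceNorm_sub_cfc_min_le (T := tensorOp fun i => A i ^ (((j + 1 : ℕ) : ℝ)⁻¹))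
    (tensorOp_nonneg fun i => CFC.rpow_nonneg) j hν
  rw [tensorOp_root_pow_self hA (by omega)] at h
  exact h.trans (mul_le_mul_right (traceNorm_tensorOp_root_pow_le hA (j + 1) (j + 2)) _)

theorem traceNorm_conj_one_sub_cfc_tensorOp_le {A : Fin n → H →L[ℂ] H} (hA : ∀ i, 0 ≤ A i) (j : ℕ)
    {ν : ℝ} (hν : 0 < ν) :
    traceNorm ((1 - cfc (fun t : ℝ => min 1 (t / ν ^ (j + 1))) (tensorOp A)) * tensorOp A
        * (1 - cfc (fun t : ℝ => min 1 (t / ν ^ (j + 1))) (tensorOp A)))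
      ≤ ENNReal.ofReal ν * ∏ i, traceNorm (A i ^ ((j : ℝ) / (j + 1 : ℕ))) := by
  have h := traceNorm_conj_one_sub_cfc_le (T := tensorOp fun i => A i ^ (((j + 1 : ℕ) : ℝ)⁻¹))
    (tensorOp_nonneg fun i => CFC.rpow_nonneg) j hν
  rw [tensorOp_root_pow_self hA (by omega)] at h
  exact h.trans (mul_le_mul_right (traceNorm_tensorOp_root_pow_le hA (j + 1) j) _)

end Powers

/-! ### The n-fold channel and its covering bound -/

section Channel

variable {X : Type*} [MeasurableSpace X]
  {H : Type*} [NormedAddCommGroup H] [InnerProductSpace ℂ H] [CompleteSpace H]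
  [TopologicalSpace.SeparableSpace H] {D : X → DensityOperator H}

omit [MeasurableSpace X] [TopologicalSpace.SeparableSpace H] in
theorem norm_density_le_one (A : DensityOperator H) : ‖A.1.op‖ ≤ 1 :=
  norm_le_one_of_traceNorm_le_one (DensityOperator.traceNorm_eq_one A).le

/-- Strong measurability comes from the trace class, which is separable; the bounded operators need
not be. -/
theorem stronglyMeasurable_op (hD : Measurable D) : StronglyMeasurable fun x => (D x).1.op := by
  have : SecondCountableTopology (TraceClass H) :=
    UniformSpace.secondCountable_of_separable _
  have h1 : StronglyMeasurable fun x => (D x : TraceClass H) :=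
    (measurable_subtype_coe.comp hD).stronglyMeasurable
  exact (TraceClass.opCLM H).continuous.comp_stronglyMeasurable h1

theorem integrable_density (hD : Measurable D) (P : Measure X) [IsProbabilityMeasure P] :
    Integrable (fun x => (D x : TraceClass H)) P := by
  have : SecondCountableTopology (TraceClass H) :=
    UniformSpace.secondCountable_of_separable _
  refine integrable_of_norm_le (C := 1) (measurable_subtype_coe.comp hD).stronglyMeasurable
    fun x => ?_
  rw [TraceClass.norm_def, DensityOperator.traceNorm_eq_one]
  simp

variable {P : Measure X} [IsProbabilityMeasure P]

theorem integrable_op (hD : Measurable D) : Integrable (fun x => (D x).1.op) P :=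
  integrable_of_norm_le (stronglyMeasurable_op hD) fun x => norm_density_le_one (D x)

/-- The inclusion of the trace class is continuous, so the Bochner integrals in the two norms agree;
later arguments use the operator norm only. -/
theorem avgOutput_op (hD : Measurable D) : (avgOutput P D).op = ∫ x, (D x).1.op ∂P :=
  ((TraceClass.opCLM H).integral_comp_comm (integrable_density hD P)).symm

theorem avgOutput_op_nonneg (hD : Measurable D) : 0 ≤ (avgOutput P D).op := by
  rw [avgOutput_op hD]
  exact integral_nonneg fun x => (D x).2.1

theorem traceNorm_avgOutput_le (hD : Measurable D) : traceNorm (avgOutput P D).op ≤ 1 := by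
  rw [avgOutput_op hD]
  refine (traceNorm_integral_le (integrable_op hD)).trans_eq ?_
  simp [DensityOperator.traceNorm_eq_one]

variable {n : ℕ}

theorem stronglyMeasurable_channelPow (hD : Measurable D) :
    StronglyMeasurable fun x : Fin n → X => channelPow D x := by
  have : SecondCountableTopology (TraceClass H) :=
    UniformSpace.secondCountable_of_separable _
  have h1 : StronglyMeasurable fun (x : Fin n → X) (i : Fin n) => (D (x i) : TraceClass H) :=
    (measurable_pi_lambda _ fun i =>
      (measurable_subtype_coe.comp hD).comp (measurable_pi_apply i)).stronglyMeasurable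
  have h2 : Continuous fun A : Fin n → TraceClass H => tensorOp fun i => (A i).op :=
    continuous_tensorOp.comp (continuous_pi fun i =>
      (TraceClass.opCLM H).continuous.comp (continuous_apply i))
  exact h2.comp_stronglyMeasurable h1

omit [MeasurableSpace X] [TopologicalSpace.SeparableSpace H] in
theorem channelPow_nonneg (x : Fin n → X) : 0 ≤ channelPow D x :=
  tensorOp_nonneg fun i => (D (x i)).2.1

omit [MeasurableSpace X] [TopologicalSpace.SeparableSpace H] in
theorem traceNorm_channelPow_le (x : Fin n → X) : traceNorm (channelPow D x) ≤ 1 := by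
  refine (traceNorm_tensorOp_le fun i => (D (x i)).2.1).trans ?_
  simp [DensityOperator.traceNorm_eq_one]

theorem tensorOp_avgOutput (hD : Measurable D) :
    tensorOp (fun _ : Fin n => (avgOutput P D).op)
      = ∫ x : Fin n → X, channelPow D x ∂(Measure.pi fun _ => P) := by
  rw [avgOutput_op hD]
  exact tensorOp_integral (integrable_op hD)
    (integrable_of_norm_le (stronglyMeasurable_channelPow hD) fun x =>
      norm_le_one_of_traceNorm_le_one (traceNorm_channelPow_le x))

/-- Independence of the letters: moments at block length n become n-th powers of single-letter
moments. -/
theorem lintegral_pi_prod {f : X → ℝ≥0∞} (hf : Measurable f) :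
    ∫⁻ x : Fin n → X, ∏ i, f (x i) ∂(Measure.pi fun _ => P) = (∫⁻ x, f x ∂P) ^ n := by
  have hi := ProbabilityTheory.iIndepFun_pi (μ := fun _ : Fin n => P) (X := fun _ => f)
    (fun _ => hf.aemeasurable)
  rw [ProbabilityTheory.lintegral_prod_eq_prod_lintegral_of_indepFun _ _ hi
    fun i => hf.comp (measurable_pi_apply i)]
  have h : ∀ i : Fin n, ∫⁻ x : Fin n → X, f (x i) ∂(Measure.pi fun _ => P) = ∫⁻ x, f x ∂P := fun i =>
    (measurePreserving_eval (fun _ : Fin n => P) i).lintegral_comp hf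
  simp [h]

theorem measurable_traceNorm_cfc (hD : Measurable D) {φ : ℝ → ℝ} (hφ : Continuous φ) :
    Measurable fun x => traceNorm (cfc φ (D x).1.op) :=
  measurable_traceNorm_of_stronglyMeasurable (stronglyMeasurable_cfc (stronglyMeasurable_op hD)
    (fun x => (D x).2.1) (fun _ => norm_density_le_one _) hφ.continuousOn)

theorem measurable_traceNorm_rpow (hD : Measurable D) {p : ℝ} (hp : 0 ≤ p) :
    Measurable fun x => traceNorm ((D x).1.op ^ p) := by
  have h : ∀ x, (D x).1.op ^ p = cfc (fun t : ℝ => t ^ p) (D x).1.op := fun x =>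
    CFC.rpow_eq_cfc_real (D x).2.1
  simp only [h]
  exact measurable_traceNorm_cfc hD (Real.continuous_rpow_const hp)

/-- Covering bound for block length `n` with the Rényi-type moments of orders `1 ± 1 / (j + 1)`. -/
theorem lintegral_codebook_le (hD : Measurable D) {M : ℕ} (hM : 0 < M) (j : ℕ)
    {ν₀ ν₁ c c' : ℝ} (hν₀ : 0 < ν₀) (hν₁ : 0 < ν₁) (hc : 0 < c) (hc' : 0 < c') :
    ∫⁻ C : Fin M → Fin n → X, traceNorm (codebookOutput D C
        - tensorOp fun _ : Fin n => (avgOutput P D).op) ∂(codebookLaw P n M)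
      ≤ 2 * (ENNReal.ofReal ν₀⁻¹
            * (∫⁻ x, traceNorm ((D x).1.op ^ (((j + 2 : ℕ) : ℝ) / (j + 1 : ℕ))) ∂P) ^ n
          + 2⁻¹ * (ENNReal.ofReal c' + ENNReal.ofReal c'⁻¹ * (ENNReal.ofReal ν₁
            * traceNorm ((avgOutput P D).op ^ ((j : ℝ) / (j + 1 : ℕ))) ^ n)))
        + 2⁻¹ * (ENNReal.ofReal c * ((M : ℝ≥0∞)⁻¹ * ENNReal.ofReal (ν₀ ^ (j + 1)))
          + ENNReal.ofReal c⁻¹ * ENNReal.ofReal (ν₁ ^ (j + 1))⁻¹) := by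
  set ρ := tensorOp fun _ : Fin n => (avgOutput P D).op with hρ
  set μ₀ := ν₀ ^ (j + 1) with hμ₀
  -- B damps the eigenvalues of ρ below ν₁^(j+1) and keeps the others, a continuous stand-in for the
  -- typical projection of the average state.
  set B := cfc (fun t : ℝ => min 1 (t / ν₁ ^ (j + 1))) ρ with hB
  -- G caps the spectrum of the codeword state at μ₀. Capping, unlike cutting off, is continuous in
  -- the state, so G is measurable, and it stays below the state.
  set G : (Fin n → X) → TensorPower n H →L[ℂ] TensorPower n H :=
    fun x => cfc (fun t : ℝ => min t μ₀) (channelPow D x) with hG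
  have hμ₀0 : 0 < μ₀ := by positivity
  have hF := stronglyMeasurable_channelPow (n := n) hD
  have hF1 : ∀ x : Fin n → X, ‖channelPow D x‖ ≤ 1 := fun x =>
    norm_le_one_of_traceNorm_le_one (traceNorm_channelPow_le x)
  have hGm : StronglyMeasurable G :=
    stronglyMeasurable_cfc hF channelPow_nonneg hF1 (by fun_prop)
  have hGF : ∀ x, G x ≤ channelPow D x := fun x => cfc_min_le (channelPow_nonneg x) _
  have hG0 : ∀ x, 0 ≤ G x := fun x => cfc_min_nonneg (channelPow_nonneg x) hμ₀0.le
  have hG1 : ∀ x, ‖G x‖ ≤ 1 := fun x =>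
    (CStarAlgebra.norm_le_norm_of_nonneg_of_le (hG0 x) (hGF x)).trans (hF1 x)
  have hA0 : ∀ _ : Fin n, 0 ≤ (avgOutput P D).op := fun _ => avgOutput_op_nonneg hD
  have hρ0 : 0 ≤ ρ := tensorOp_nonneg hA0
  have hρ1 : traceNorm ρ ≤ 1 :=
    (traceNorm_tensorOp_le hA0).trans (Finset.prod_le_one' fun _ _ => traceNorm_avgOutput_le hD)
  have hρint : ρ = ∫ x : Fin n → X, channelPow D x ∂(Measure.pi fun _ => P) := tensorOp_avgOutput hD
  have hBs : IsSelfAdjoint B := cfc_predicate _ _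
  have hB1 : ‖B‖ ≤ 1 := by
    refine norm_cfc_le zero_le_one fun t ht => ?_
    have h0 : 0 ≤ t := spectrum_nonneg_of_nonneg hρ0 ht
    rw [Real.norm_of_nonneg (by positivity)]
    exact min_le_left _ _
  have hBhs : hsSq B ≤ ENNReal.ofReal (ν₁ ^ (j + 1))⁻¹ := by
    refine hsSq_cfc_le hρ0 hρ1 (by fun_prop) (by positivity) fun t ht => ?_
    calc _ ≤ 1 * (t / ν₁ ^ (j + 1)) :=
          mul_le_mul (min_le_left _ _) (min_le_right _ _) (by positivity) zero_le_one
      _ = _ := by rw [one_mul, div_eq_inv_mul]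
  have hGhs : ∀ x, hsSq (G x) ≤ ENNReal.ofReal μ₀ := fun x => by
    refine hsSq_cfc_le (channelPow_nonneg x) (traceNorm_channelPow_le x) (by fun_prop) hμ₀0.le
      fun t ht => ?_
    rw [mul_comm μ₀]
    exact mul_le_mul (min_le_left _ _) (min_le_right _ _) (by positivity) ht
  have htail : ∫⁻ x : Fin n → X, traceNorm (channelPow D x - G x) ∂(Measure.pi fun _ => P)
      ≤ ENNReal.ofReal ν₀⁻¹
        * (∫⁻ x, traceNorm ((D x).1.op ^ (((j + 2 : ℕ) : ℝ) / (j + 1 : ℕ))) ∂P) ^ n := by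
    have hm := measurable_traceNorm_rpow hD (p := ((j + 2 : ℕ) : ℝ) / (j + 1 : ℕ)) (by positivity)
    have hmp : Measurable fun x : Fin n → X =>
        ∏ i, traceNorm ((D (x i)).1.op ^ (((j + 2 : ℕ) : ℝ) / (j + 1 : ℕ))) :=
      Finset.measurable_fun_prod _ fun i _ => hm.comp (measurable_pi_apply i)
    rw [← lintegral_pi_prod hm, ← lintegral_const_mul _ hmp]
    refine lintegral_mono fun x => ?_
    exact traceNorm_tensorOp_sub_cfc_min_le (fun i => (D (x i)).2.1) j hν₀
  have hBtail : traceNorm ((1 - B) * ρ * (1 - B)) ≤ ENNReal.ofReal ν₁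
      * traceNorm ((avgOutput P D).op ^ ((j : ℝ) / (j + 1 : ℕ))) ^ n := by
    refine (traceNorm_conj_one_sub_cfc_tensorOp_le hA0 j hν₁).trans_eq ?_
    simp
  have h1 := lintegral_traceNorm_sub_mul_le (Q := Measure.pi fun _ : Fin n => P) hF hGm
    channelPow_nonneg traceNorm_channelPow_le hGF hBs hB1 hc'
  rw [← hρint] at h1
  have h2 := lintegral_traceNorm_mean_sub_le (Q := Measure.pi fun _ : Fin n => P) hF hGm hF1 hG1 B
    hc hM
  rw [← hρint] at h2
  refine h2.trans ?_
  gcongr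
  · refine h1.trans ?_
    gcongr
  · refine (lintegral_mono hGhs).trans_eq ?_
    simp

theorem measurable_traceNorm_codebook (hD : Measurable D) (M : ℕ)
    (A : TensorPower n H →L[ℂ] TensorPower n H) :
    Measurable fun C : Fin M → Fin n → X => traceNorm (codebookOutput D C - A) := by
  refine measurable_traceNorm_of_stronglyMeasurable ?_
  have h : StronglyMeasurable fun C : Fin M → Fin n → X => ∑ m, channelPow D (C m) :=
    Finset.stronglyMeasurable_fun_sum _ fun m _ =>
      (stronglyMeasurable_channelPow hD).comp_measurable (measurable_pi_apply m)
  exact (h.const_smul (1 / (M : ℂ))).sub stronglyMeasurable_const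

end Channel

/-! ### Expansion of single-letter moments around order 1 -/

section OneLetter

theorem abs_exp_sub_one_sub_le (y : ℝ) : |Real.exp y - 1 - y| ≤ y ^ 2 * Real.exp |y| := by
  have h := Complex.norm_exp_sub_sum_le_norm_mul_exp (y : ℂ) 2
  simp only [Finset.sum_range_succ, Finset.sum_range_zero, pow_zero, Nat.factorial_zero,
    Nat.cast_one, div_one, zero_add, pow_one, Nat.factorial_one, Complex.norm_real,
    Real.norm_eq_abs, sq_abs] at h
  have e : Complex.exp y - (1 + y) = ((Real.exp y - 1 - y : ℝ) : ℂ) := by push_cast; ring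
  rwa [e, Complex.norm_real] at h

/-- With s = -log t, this expands exp(-ηs) to second order. The remainder η² s² exp(|η| s) spends
half of exp((1-α)s) on |η| s and half on s², and t exp((1-α)s) = t^α. The constant is uniform in t,
so traces and expectations can be taken. -/
theorem rpow_one_add_le {α : ℝ} (hα : α < 1) (hα0 : 0 < α) {η : ℝ} (hη : |η| ≤ (1 - α) / 2) {t : ℝ}
    (h0 : 0 ≤ t) (h1 : t ≤ 1) :
    t ^ (1 + η) ≤ t + η * (t * Real.log t) + 8 / (1 - α) ^ 2 * η ^ 2 * t ^ α := by
  obtain ⟨hη1, hη2⟩ := abs_le.1 hη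
  rcases h0.eq_or_lt with rfl | ht
  · rw [Real.zero_rpow (by linarith), Real.zero_rpow hα0.ne']
    simp
  set s := -Real.log t with hs
  have hs0 : 0 ≤ s := by
    have := Real.log_nonpos h0 h1
    linarith
  have hβ : 0 < 1 - α := by linarith
  have e1 : t ^ (1 + η) = t * Real.exp (-(η * s)) := by
    rw [Real.rpow_add ht, Real.rpow_one, Real.rpow_def_of_pos ht]
    congr 2
    rw [hs]; ring
  have e2 : t ^ α = t * Real.exp ((1 - α) * s) := by
    conv_rhs => rw [← Real.exp_log ht]
    rw [Real.rpow_def_of_pos ht, ← Real.exp_add]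
    congr 1
    rw [hs]; ring
  have h2 := (abs_le.1 (abs_exp_sub_one_sub_le (-(η * s)))).2
  have h3 : |-(η * s)| ≤ (1 - α) / 2 * s := by
    rw [abs_neg, abs_mul, abs_of_nonneg hs0]
    gcongr
  -- From x²/2 ≤ exp x at x = (1 - α) s / 2; this is the origin of the constant 8.
  have h4 : s ^ 2 ≤ 8 / (1 - α) ^ 2 * Real.exp ((1 - α) / 2 * s) := by
    have h5 := Real.quadratic_le_exp_of_nonneg (x := (1 - α) / 2 * s) (by positivity)
    have h6 : ((1 - α) / 2 * s) ^ 2 / 2 ≤ Real.exp ((1 - α) / 2 * s) := by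
      have : 0 ≤ (1 - α) / 2 * s := by positivity
      linarith
    have e3 : s ^ 2 = 8 / (1 - α) ^ 2 * (((1 - α) / 2 * s) ^ 2 / 2) := by field_simp; ring
    rw [e3]
    gcongr
  have h5 : (-(η * s)) ^ 2 * Real.exp |-(η * s)|
      ≤ 8 / (1 - α) ^ 2 * η ^ 2 * Real.exp ((1 - α) * s) := by
    calc (-(η * s)) ^ 2 * Real.exp |-(η * s)|
        ≤ (η ^ 2 * (8 / (1 - α) ^ 2 * Real.exp ((1 - α) / 2 * s)))
          * Real.exp ((1 - α) / 2 * s) := by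
          rw [neg_sq, mul_pow]
          gcongr
      _ = 8 / (1 - α) ^ 2 * η ^ 2
          * (Real.exp ((1 - α) / 2 * s) * Real.exp ((1 - α) / 2 * s)) := by ring
      _ = _ := by rw [← Real.exp_add]; congr 2; ring
  have h6 : Real.exp (-(η * s))
      ≤ 1 - η * s + 8 / (1 - α) ^ 2 * η ^ 2 * Real.exp ((1 - α) * s) := by linarith
  rw [e1, e2]
  have h7 := mul_le_mul_of_nonneg_left h6 h0
  have e4 : Real.log t = -s := by rw [hs]; ring
  rw [e4]
  linarith

variable {H : Type*} [NormedAddCommGroup H] [InnerProductSpace ℂ H] [CompleteSpace H]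

theorem neg_mulLog (A : H →L[ℂ] H) : -mulLog A = cfc Real.negMulLog A := by
  rw [mulLog, ← cfc_neg]
  congr 1
  funext t
  simp [Real.negMulLog]

/-- Since -t log t ≥ 0 on [0, 1], the trace norm of A log A is the entropy, with values in [0, ∞].
-/
theorem neg_mulLog_nonneg {A : H →L[ℂ] H} (hA : 0 ≤ A) (hA1 : ‖A‖ ≤ 1) : 0 ≤ -mulLog A := by
  rw [neg_mulLog]
  exact cfc_nonneg fun t ht =>
    Real.negMulLog_nonneg (spectrum_subset_Icc hA hA1 ht).1 (spectrum_subset_Icc hA hA1 ht).2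

theorem trace_mulLog_re {A : H →L[ℂ] H} (hA : 0 ≤ A) (hA1 : ‖A‖ ≤ 1)
    (ht : IsTraceClass (mulLog A)) : (trace (mulLog A)).re = -(traceNorm (mulLog A)).toReal := by
  have ht' : IsTraceClass (-mulLog A) := by rwa [IsTraceClass, traceNorm_neg]
  have h := trace_re_of_nonneg (neg_mulLog_nonneg hA hA1) ht'
  rw [trace_neg, traceNorm_neg, Complex.neg_re] at h
  linarith

/-- First-order expansion of `A ^ (1 + η)` at `η = 0`. -/
theorem rpow_one_add_le_add {A : H →L[ℂ] H} (hA : 0 ≤ A) (hA1 : ‖A‖ ≤ 1) {α : ℝ} (hα0 : 0 < α)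
    (hα1 : α < 1) {η : ℝ} (hη : |η| ≤ (1 - α) / 2) :
    A ^ (1 + η) ≤ A + η • mulLog A + (8 / (1 - α) ^ 2 * η ^ 2) • A ^ α := by
  have hη1 : 0 ≤ 1 + η := by linarith [(abs_le.1 hη).1]
  have hlog : Continuous fun t : ℝ => t * Real.log t := Real.continuous_mul_log
  have c1 : Continuous fun t : ℝ => t ^ (1 + η) := Real.continuous_rpow_const hη1
  have c2 : Continuous fun t : ℝ => t ^ α := Real.continuous_rpow_const hα0.le
  have c3 : Continuous fun t : ℝ => η * (t * Real.log t) := continuous_const.mul hlog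
  have c4 : Continuous fun t : ℝ => t + η * (t * Real.log t) := continuous_id.add c3
  have c5 : Continuous fun t : ℝ => 8 / (1 - α) ^ 2 * η ^ 2 * t ^ α := continuous_const.mul c2
  have e : A + η • mulLog A + (8 / (1 - α) ^ 2 * η ^ 2) • A ^ α
      = cfc (fun t : ℝ => t + η * (t * Real.log t) + 8 / (1 - α) ^ 2 * η ^ 2 * t ^ α) A := by
    rw [cfc_add A (fun t : ℝ => t + η * (t * Real.log t))
        (fun t : ℝ => 8 / (1 - α) ^ 2 * η ^ 2 * t ^ α) c4.continuousOn c5.continuousOn,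
      cfc_add A (fun t : ℝ => t) (fun t : ℝ => η * (t * Real.log t)) continuousOn_id
        c3.continuousOn,
      cfc_const_mul _ (fun t : ℝ => t * Real.log t) A hlog.continuousOn,
      cfc_const_mul _ (fun t : ℝ => t ^ α) A c2.continuousOn, cfc_id' ℝ A, mulLog,
      CFC.rpow_eq_cfc_real hA]
  rw [e, CFC.rpow_eq_cfc_real hA]
  exact cfc_mono (fun t ht => rpow_one_add_le hα1 hα0 hη (spectrum_subset_Icc hA hA1 ht).1
    (spectrum_subset_Icc hA hA1 ht).2) c1.continuousOn (c4.add c5).continuousOn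

theorem traceNorm_rpow_one_add_le {A : H →L[ℂ] H} (hA : 0 ≤ A) (hAt : traceNorm A ≤ 1) {α : ℝ}
    (hα0 : 0 < α) (hα1 : α < 1) {ε : ℝ} (hε : 0 < ε) (hεα : ε ≤ (1 - α) / 2) :
    traceNorm (A ^ (1 + ε)) + ENNReal.ofReal ε * traceNorm (mulLog A)
      ≤ 1 + ENNReal.ofReal (8 / (1 - α) ^ 2 * ε ^ 2) * traceNorm (A ^ α) := by
  have hA1 := norm_le_one_of_traceNorm_le_one hAt
  have h := rpow_one_add_le_add hA hA1 hα0 hα1 (η := ε) (by rwa [abs_of_pos hε])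
  have hN := neg_mulLog_nonneg hA hA1
  have hp : 0 ≤ ε • -mulLog A := smul_nonneg hε.le hN
  -- The entropy term moves to the left, so that all summands are positive: trace norms then add
  -- exactly and no subtraction in [0, ∞] arises.
  have h1 : A ^ (1 + ε) + ε • -mulLog A ≤ A + (8 / (1 - α) ^ 2 * ε ^ 2) • A ^ α := by
    rw [smul_neg, ← sub_eq_add_neg, sub_le_iff_le_add]
    exact h.trans_eq (add_right_comm _ _ _)
  have h3 := traceNorm_mono (add_nonneg CFC.rpow_nonneg hp) h1
  rw [traceNorm_add_of_nonneg CFC.rpow_nonneg hp, traceNorm_real_smul hε.le, traceNorm_neg] at h3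
  refine h3.trans ((traceNorm_add_le _ _).trans ?_)
  rw [traceNorm_real_smul (by positivity)]
  gcongr

theorem traceNorm_rpow_one_sub_le {A : H →L[ℂ] H} (hA : 0 ≤ A) (hAt : traceNorm A ≤ 1) {α : ℝ}
    (hα0 : 0 < α) (hα1 : α < 1) {ε : ℝ} (hε : 0 < ε) (hεα : ε ≤ (1 - α) / 2) :
    traceNorm (A ^ (1 - ε)) ≤ 1 + ENNReal.ofReal ε * traceNorm (mulLog A)
      + ENNReal.ofReal (8 / (1 - α) ^ 2 * ε ^ 2) * traceNorm (A ^ α) := by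
  have hA1 := norm_le_one_of_traceNorm_le_one hAt
  have h := rpow_one_add_le_add hA hA1 hα0 hα1 (η := -ε) (by rwa [abs_neg, abs_of_pos hε])
  rw [neg_smul, ← smul_neg, neg_sq, ← sub_eq_add_neg] at h
  refine (traceNorm_mono CFC.rpow_nonneg h).trans ((traceNorm_add_le _ _).trans ?_)
  rw [traceNorm_real_smul (by positivity)]
  gcongr
  refine (traceNorm_add_le _ _).trans ?_
  rw [traceNorm_real_smul hε.le, traceNorm_neg]
  gcongr

end OneLetter

/-! ### Mutual information as a difference of entropies -/

section MutualInfo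

variable {X : Type*} [MeasurableSpace X]
  {H : Type*} [NormedAddCommGroup H] [InnerProductSpace ℂ H] [CompleteSpace H]
  [TopologicalSpace.SeparableSpace H] {D : X → DensityOperator H}
  {P : Measure X} [IsProbabilityMeasure P]

theorem measurable_traceNorm_mulLog (hD : Measurable D) :
    Measurable fun x => traceNorm (mulLog (D x).1.op) :=
  measurable_traceNorm_cfc hD Real.continuous_mul_log

theorem lintegral_rpow_one_add_le (hD : Measurable D) {α : ℝ}
    (hα0 : 0 < α) (hα1 : α < 1) {ε : ℝ} (hε : 0 < ε) (hεα : ε ≤ (1 - α) / 2) :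
    ∫⁻ x, traceNorm ((D x).1.op ^ (1 + ε)) ∂P
        + ENNReal.ofReal ε * ∫⁻ x, traceNorm (mulLog (D x).1.op) ∂P
      ≤ 1 + ENNReal.ofReal (8 / (1 - α) ^ 2 * ε ^ 2) * ∫⁻ x, traceNorm ((D x).1.op ^ α) ∂P := by
  have h := lintegral_mono (μ := P) fun x => traceNorm_rpow_one_add_le (D x).2.1
    (DensityOperator.traceNorm_eq_one (D x)).le hα0 hα1 hε hεα
  rw [lintegral_add_left (measurable_traceNorm_rpow hD (by positivity)),
    lintegral_const_mul _ (measurable_traceNorm_mulLog hD), lintegral_add_left measurable_const,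
    lintegral_const_mul _ (measurable_traceNorm_rpow hD hα0.le)] at h
  simpa using h

omit [IsProbabilityMeasure P] [TopologicalSpace.SeparableSpace H] in
-- This is where existence of the Bochner integral of D(X)^α enters: it makes the second-order error
-- finite.
theorem lintegral_traceNorm_lt_top {A : X → H →L[ℂ] H} (h1 : ∀ᵐ x ∂P, IsTraceClass (A x))
    (h2 : Integrable (fun x => toTraceClass (A x)) P) : ∫⁻ x, traceNorm (A x) ∂P < ∞ := by
  refine lt_of_le_of_lt (lintegral_mono_ae ?_) h2.2
  filter_upwards [h1] with x hx
  rw [← ofReal_norm, toTraceClass, dif_pos hx, TraceClass.norm_def]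
  exact (ENNReal.ofReal_toReal hx.ne).ge

theorem mutualInfo_eq (hD : Measurable D)
    (h1 : ∀ᵐ x ∂P, IsTraceClass (mulLog (D x).1.op)) (h2 : IsTraceClass (mulLog (avgOutput P D).op)) :
    mutualInfo P D = (((traceNorm (mulLog (avgOutput P D).op)).toReal
      - (∫⁻ x, traceNorm (mulLog (D x).1.op) ∂P).toReal : ℝ) : EReal) := by
  rw [mutualInfo, if_pos ⟨h1, h2⟩, trace_mulLog_re (avgOutput_op_nonneg hD)
    (norm_le_one_of_traceNorm_le_one (traceNorm_avgOutput_le hD)) h2]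
  have h3 : ∫ x, (trace (mulLog (D x).1.op)).re ∂P
      = ∫ x, -(traceNorm (mulLog (D x).1.op)).toReal ∂P := by
    refine integral_congr_ae ?_
    filter_upwards [h1] with x hx
    exact trace_mulLog_re (D x).2.1 (norm_density_le_one _) hx
  rw [h3, integral_neg, integral_toReal (measurable_traceNorm_mulLog hD).aemeasurable h1]
  congr 1
  ring

end MutualInfo

/-! ### Choice of levels and bookkeeping of exponents -/

section Exponents

/-- This is 1 + x ≤ exp x. Finiteness of the right side forces W and h to be finite, so the
finiteness of the mean entropy is a consequence and not a hypothesis. -/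
theorem le_ofReal_exp_of_add_le {W h K : ℝ≥0∞} {ε C : ℝ} (hε : 0 < ε) (hC : 0 ≤ C)
    (hK : K ≠ ∞) (hle : W + ENNReal.ofReal ε * h ≤ 1 + ENNReal.ofReal C * K) :
    W ≤ ENNReal.ofReal (Real.exp (C * K.toReal - ε * h.toReal)) := by
  have hfin : 1 + ENNReal.ofReal C * K ≠ ∞ :=
    ENNReal.add_ne_top.2 ⟨ENNReal.one_ne_top, ENNReal.mul_ne_top ENNReal.ofReal_ne_top hK⟩
  have hsum := ne_top_of_le_ne_top hfin hle
  have hW : W ≠ ∞ := (ENNReal.add_ne_top.1 hsum).1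
  have hh : ENNReal.ofReal ε * h ≠ ∞ := (ENNReal.add_ne_top.1 hsum).2
  have h1 := ENNReal.toReal_mono hfin hle
  rw [ENNReal.toReal_add hW hh, ENNReal.toReal_mul, ENNReal.toReal_ofReal hε.le,
    ENNReal.toReal_add ENNReal.one_ne_top (ENNReal.mul_ne_top ENNReal.ofReal_ne_top hK),
    ENNReal.toReal_mul, ENNReal.toReal_ofReal hC, ENNReal.toReal_one] at h1
  rw [← ENNReal.ofReal_toReal hW]
  refine ENNReal.ofReal_le_ofReal ?_
  have h2 := Real.add_one_le_exp (C * K.toReal - ε * h.toReal)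
  linarith

theorem le_ofReal_exp_of_le_add {V S K : ℝ≥0∞} {ε C : ℝ} (hε : 0 < ε) (hC : 0 ≤ C)
    (hK : K ≠ ∞) (hS : S ≠ ∞) (hle : V ≤ 1 + ENNReal.ofReal ε * S + ENNReal.ofReal C * K) :
    V ≤ ENNReal.ofReal (Real.exp (C * K.toReal + ε * S.toReal)) := by
  refine hle.trans ?_
  rw [← ENNReal.ofReal_toReal hK, ← ENNReal.ofReal_toReal hS, ← ENNReal.ofReal_one,
    ← ENNReal.ofReal_mul hε.le, ← ENNReal.ofReal_mul hC, ← ENNReal.ofReal_add (by positivity)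
    (by positivity), ← ENNReal.ofReal_add (by positivity) (by positivity)]
  refine ENNReal.ofReal_le_ofReal ?_
  rw [ENNReal.toReal_ofReal (by positivity), ENNReal.toReal_ofReal (by positivity)]
  have h2 := Real.add_one_le_exp (C * K.toReal + ε * S.toReal)
  linarith

/-- The exponents in the covering bound, for levels `exp (-n ε (h - δ))` and `exp (-n ε (S + δ))`
with `ε = 1 / (j + 1)`. -/
theorem covering_exponent_le {W V : ℝ≥0∞} {h S δ R : ℝ} (hδ : 0 < δ) (hR : R = S - h + 4 * δ)
    (j : ℕ) (hW : W ≤ ENNReal.ofReal (Real.exp ((j + 1 : ℝ)⁻¹ * (-h + δ / 2))))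
    (hV : V ≤ ENNReal.ofReal (Real.exp ((j + 1 : ℝ)⁻¹ * (S + δ / 2)))) (n M : ℕ)
    (hM : Real.exp (n * R) ≤ M) :
    ∃ ν₀ ν₁ c c' : ℝ, 0 < ν₀ ∧ 0 < ν₁ ∧ 0 < c ∧ 0 < c' ∧
      2 * (ENNReal.ofReal ν₀⁻¹ * W ^ n
          + 2⁻¹ * (ENNReal.ofReal c' + ENNReal.ofReal c'⁻¹ * (ENNReal.ofReal ν₁ * V ^ n)))
        + 2⁻¹ * (ENNReal.ofReal c * ((M : ℝ≥0∞)⁻¹ * ENNReal.ofReal (ν₀ ^ (j + 1)))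
          + ENNReal.ofReal c⁻¹ * ENNReal.ofReal (ν₁ ^ (j + 1))⁻¹)
        ≤ ENNReal.ofReal (5 * Real.exp (-(n * ((j + 1 : ℝ)⁻¹ * δ / 4)))) := by
  set ε : ℝ := (j + 1 : ℝ)⁻¹ with hε
  have hj : (0 : ℝ) < j + 1 := by positivity
  have hε0 : 0 < ε := inv_pos.2 hj
  have hε1 : ε ≤ 1 := inv_le_one_of_one_le₀ (by linarith [(Nat.cast_nonneg j : (0 : ℝ) ≤ j)])
  have hεj : ε * (j + 1) = 1 := inv_mul_cancel₀ hj.ne'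
  have hMpos : (0 : ℝ) < M := (Real.exp_pos _).trans_le hM
  have hpow : ∀ x : ℝ, Real.exp x ^ (j + 1) = Real.exp (x * (j + 1)) := fun x => by
    rw [← Real.exp_nat_mul]; push_cast; congr 1; ring
  have hpown : ∀ (x : ℝ) (U : ℝ≥0∞), U ≤ ENNReal.ofReal (Real.exp x) →
      U ^ n ≤ ENNReal.ofReal (Real.exp (n * x)) := fun x U hU => by
    rw [Real.exp_nat_mul, ENNReal.ofReal_pow (Real.exp_pos _).le]
    gcongr
  -- Since ε (j + 1) = 1, the spectral levels are exp(-n(h - δ)) and exp(-n(S + δ)). The weight c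
  -- makes both variance terms exp(-nδ). The second tail is exp(-nεδ/2), and c' is its square root.
  refine ⟨Real.exp (-(n * (ε * (h - δ)))), Real.exp (-(n * (ε * (S + δ)))),
    Real.exp (n * ((S + h + R) / 2)), Real.exp (-(n * (ε * δ / 4))), Real.exp_pos _, Real.exp_pos _,
    Real.exp_pos _, Real.exp_pos _, ?_⟩
  have b1 : ENNReal.ofReal (Real.exp (-(n * (ε * (h - δ)))))⁻¹ * W ^ n
      ≤ ENNReal.ofReal (Real.exp (-(n * (ε * δ / 4)))) := by
    refine (mul_le_mul_right (hpown _ W hW) _).trans ?_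
    rw [← Real.exp_neg, ← ENNReal.ofReal_mul (Real.exp_pos _).le, ← Real.exp_add]
    refine ENNReal.ofReal_le_ofReal (Real.exp_le_exp.2 ?_)
    have : 0 ≤ (n : ℝ) * (ε * δ / 4) := by positivity
    nlinarith
  have b2 : ENNReal.ofReal (Real.exp (-(n * (ε * δ / 4))))⁻¹
      * (ENNReal.ofReal (Real.exp (-(n * (ε * (S + δ))))) * V ^ n)
      ≤ ENNReal.ofReal (Real.exp (-(n * (ε * δ / 4)))) := by
    refine (mul_le_mul_right (mul_le_mul_right (hpown _ V hV) _) _).trans ?_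
    rw [← Real.exp_neg, ← ENNReal.ofReal_mul (Real.exp_pos _).le,
      ← ENNReal.ofReal_mul (Real.exp_pos _).le, ← Real.exp_add, ← Real.exp_add]
    refine ENNReal.ofReal_le_ofReal (Real.exp_le_exp.2 (le_of_eq ?_))
    ring
  have b3 : ENNReal.ofReal (Real.exp (n * ((S + h + R) / 2)))
      * ((M : ℝ≥0∞)⁻¹ * ENNReal.ofReal (Real.exp (-(n * (ε * (h - δ)))) ^ (j + 1)))
      ≤ ENNReal.ofReal (Real.exp (-(n * (ε * δ / 4)))) := by
    have hMi : (M : ℝ≥0∞)⁻¹ ≤ ENNReal.ofReal (Real.exp (-(n * R))) := by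
      rw [← ENNReal.ofReal_natCast, ← ENNReal.ofReal_inv_of_pos hMpos, Real.exp_neg]
      exact ENNReal.ofReal_le_ofReal (inv_anti₀ (Real.exp_pos _) hM)
    refine (mul_le_mul_right (mul_le_mul_left hMi _) _).trans ?_
    rw [hpow, ← ENNReal.ofReal_mul (Real.exp_pos _).le, ← ENNReal.ofReal_mul (Real.exp_pos _).le,
      ← Real.exp_add, ← Real.exp_add]
    refine ENNReal.ofReal_le_ofReal (Real.exp_le_exp.2 ?_)
    have e : -(n * (ε * (h - δ))) * (j + 1 : ℝ) = -(n * (h - δ)) * (ε * (j + 1)) := by ring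
    rw [e, hεj, hR]
    have h1 : (n : ℝ) * (ε * δ / 4) ≤ n * δ := by
      gcongr
      nlinarith
    linarith
  have b4 : ENNReal.ofReal (Real.exp (n * ((S + h + R) / 2)))⁻¹
      * ENNReal.ofReal (Real.exp (-(n * (ε * (S + δ)))) ^ (j + 1))⁻¹
      ≤ ENNReal.ofReal (Real.exp (-(n * (ε * δ / 4)))) := by
    rw [hpow, ← Real.exp_neg, ← Real.exp_neg, ← ENNReal.ofReal_mul (Real.exp_pos _).le,
      ← Real.exp_add]
    refine ENNReal.ofReal_le_ofReal (Real.exp_le_exp.2 ?_)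
    have e : -(-(n * (ε * (S + δ))) * (j + 1 : ℝ)) = (n * (S + δ)) * (ε * (j + 1)) := by ring
    rw [e, hεj, hR]
    have h1 : (n : ℝ) * (ε * δ / 4) ≤ n * δ := by
      gcongr
      nlinarith
    linarith
  set E := ENNReal.ofReal (Real.exp (-(n * (ε * δ / 4)))) with hE
  have half : ∀ x : ℝ≥0∞, 2⁻¹ * (x + x) = x := fun x => by
    rw [← two_mul, ← mul_assoc, ENNReal.inv_mul_cancel (by norm_num) (by norm_num), one_mul]
  -- All four contributions are at most E; they add up to 2 · 2E + E.
  calc _ ≤ 2 * (E + 2⁻¹ * (E + E)) + 2⁻¹ * (E + E) := by gcongr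
    _ = 5 * E := by rw [half]; ring
    _ = _ := by rw [ENNReal.ofReal_mul (by norm_num)]; simp [hE]

end Exponents

end CQ

/-! ### The covering theorem -/

theorem theorem2 {X : Type*} [MeasurableSpace X]
    {H : Type*} [NormedAddCommGroup H] [InnerProductSpace ℂ H] [CompleteSpace H]
    [TopologicalSpace.SeparableSpace H]
    (D : X → CQ.DensityOperator H) (hD : Measurable D)
    (P : Measure X) [IsProbabilityMeasure P]
    (R : ℝ) (hR : CQ.mutualInfo P D < (R : EReal))
    (hα : ∃ α : ℝ, 0 < α ∧ α < 1 ∧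
      CQ.IsTraceClass ((CQ.avgOutput P D).op ^ α) ∧
      (∀ᵐ x ∂P, CQ.IsTraceClass ((D x).1.op ^ α)) ∧
      Integrable (fun x => CQ.toTraceClass ((D x).1.op ^ α)) P) :
    ∃ γ : ℝ, 0 < γ ∧ ∀ᶠ n : ℕ in Filter.atTop, ∀ M : ℕ, Real.exp (n * R) ≤ M →
      AEMeasurable (fun C : Fin M → Fin n → X =>
        CQ.traceNorm (CQ.codebookOutput D C
          - CQ.tensorOp fun _ : Fin n => (CQ.avgOutput P D).op)) (CQ.codebookLaw P n M) ∧
      ∫⁻ C : Fin M → Fin n → X,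
        CQ.traceNorm (CQ.codebookOutput D C
          - CQ.tensorOp fun _ : Fin n => (CQ.avgOutput P D).op) ∂(CQ.codebookLaw P n M)
        ≤ ENNReal.ofReal (Real.exp (-(n * γ))) := by
  obtain ⟨α, hα0, hα1, hαavg, hαae, hαint⟩ := hα
  -- Otherwise I(P, D) = ∞ by convention, contradicting I(P, D) < R.
  by_cases hlog : (∀ᵐ x ∂P, CQ.IsTraceClass (CQ.mulLog (D x).1.op)) ∧
      CQ.IsTraceClass (CQ.mulLog (CQ.avgOutput P D).op)
  swap
  · rw [CQ.mutualInfo, if_neg hlog] at hR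
    exact absurd hR not_top_lt
  rw [CQ.mutualInfo_eq hD hlog.1 hlog.2, EReal.coe_lt_coe_iff] at hR
  set h := ∫⁻ x, CQ.traceNorm (CQ.mulLog (D x).1.op) ∂P with hh
  set S := CQ.traceNorm (CQ.mulLog (CQ.avgOutput P D).op) with hS
  set K₀ := ∫⁻ x, CQ.traceNorm ((D x).1.op ^ α) ∂P with hK₀
  set K₁ := CQ.traceNorm ((CQ.avgOutput P D).op ^ α) with hK₁
  have hK₀fin : K₀ ≠ ∞ := (CQ.lintegral_traceNorm_lt_top hαae hαint).ne
  -- A quarter of the rate gap: each level moves by δ, and half of the gap 4δ remains for μ₀/(M μ₁).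
  set δ := (R - (S.toReal - h.toReal)) / 4 with hδ
  have hδ0 : 0 < δ := by rw [hδ]; linarith
  have hRδ : R = S.toReal - h.toReal + 4 * δ := by rw [hδ]; ring
  set L := 8 / (1 - α) ^ 2 * (K₀.toReal + K₁.toReal) with hL
  have hL0 : 0 ≤ L := by positivity
  have hlim := tendsto_one_div_add_atTop_nhds_zero_nat (𝕜 := ℝ)
  -- ε = 1/(j + 1) must lie in the range of the expansion and make the second-order error ε² L at
  -- most εδ/2; L + 1 guards against L = 0.
  have hev := hlim.eventually (Iic_mem_nhds (show (0 : ℝ) < min ((1 - α) / 2) (δ / 2 / (L + 1)) from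
    lt_min (by linarith) (by positivity)))
  obtain ⟨j, hj⟩ := hev.exists
  rw [one_div] at hj
  set ε : ℝ := (j + 1 : ℝ)⁻¹ with hε
  have hjpos : (0 : ℝ) < j + 1 := by positivity
  have hε0 : 0 < ε := inv_pos.2 hjpos
  have hεα : ε ≤ (1 - α) / 2 := le_trans hj (min_le_left _ _)
  have hεL : ε * L ≤ δ / 2 := by
    have h1 : ε ≤ δ / 2 / (L + 1) := le_trans hj (min_le_right _ _)
    rw [le_div_iff₀ (by positivity)] at h1
    linarith
  have hup : ((j + 2 : ℕ) : ℝ) / (j + 1 : ℕ) = 1 + ε := by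
    rw [hε]; push_cast; field_simp; ring
  have hdown : (j : ℝ) / (j + 1 : ℕ) = 1 - ε := by
    rw [hε]; push_cast; field_simp; ring
  have hC : 0 ≤ 8 / (1 - α) ^ 2 * ε ^ 2 := by positivity
  have hCK : ∀ {K : ℝ}, 0 ≤ K → K ≤ K₀.toReal + K₁.toReal →
      8 / (1 - α) ^ 2 * ε ^ 2 * K ≤ ε * (δ / 2) := fun {K} hK0 hK => by
    calc 8 / (1 - α) ^ 2 * ε ^ 2 * K ≤ 8 / (1 - α) ^ 2 * ε ^ 2 * (K₀.toReal + K₁.toReal) := by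
          gcongr
      _ = ε * (ε * L) := by rw [hL]; ring
      _ ≤ ε * (δ / 2) := by gcongr
  have hW : ∫⁻ x, CQ.traceNorm ((D x).1.op ^ (((j + 2 : ℕ) : ℝ) / (j + 1 : ℕ))) ∂P
      ≤ ENNReal.ofReal (Real.exp (ε * (-h.toReal + δ / 2))) := by
    rw [hup]
    refine (CQ.le_ofReal_exp_of_add_le hε0 hC hK₀fin
      (CQ.lintegral_rpow_one_add_le hD hα0 hα1 hε0 hεα)).trans
      (ENNReal.ofReal_le_ofReal (Real.exp_le_exp.2 ?_))
    have := hCK (K := K₀.toReal) ENNReal.toReal_nonneg (by simp)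
    linarith
  have hV : CQ.traceNorm ((CQ.avgOutput P D).op ^ ((j : ℝ) / (j + 1 : ℕ)))
      ≤ ENNReal.ofReal (Real.exp (ε * (S.toReal + δ / 2))) := by
    rw [hdown]
    refine (CQ.le_ofReal_exp_of_le_add hε0 hC hαavg.ne hlog.2.ne
      (CQ.traceNorm_rpow_one_sub_le (CQ.avgOutput_op_nonneg hD) (CQ.traceNorm_avgOutput_le hD)
        hα0 hα1 hε0 hεα)).trans (ENNReal.ofReal_le_ofReal (Real.exp_le_exp.2 ?_))
    have := hCK (K := K₁.toReal) ENNReal.toReal_nonneg (by simp)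
    linarith
  have hγ : 0 < ε * δ / 8 := by positivity
  -- Half of the exponent εδ/4 is given up so that the prefactor 5 is absorbed for large n,
  -- uniformly in M.
  refine ⟨ε * δ / 8, hγ, ?_⟩
  have hlarge : ∀ᶠ n : ℕ in Filter.atTop, Real.log 5 ≤ n * (ε * δ / 8) :=
    (tendsto_natCast_atTop_atTop.atTop_mul_const hγ).eventually_ge_atTop _
  filter_upwards [hlarge] with n hn M hM
  have hMpos : 0 < M := by
    have : (0 : ℝ) < M := (Real.exp_pos _).trans_le hM
    exact_mod_cast this
  refine ⟨(CQ.measurable_traceNorm_codebook hD M _).aemeasurable, ?_⟩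
  obtain ⟨ν₀, ν₁, c, c', hν₀, hν₁, hc, hc', hle⟩ :=
    CQ.covering_exponent_le hδ0 hRδ j hW hV n M hM
  refine (CQ.lintegral_codebook_le hD hMpos j hν₀ hν₁ hc hc').trans (hle.trans ?_)
  refine ENNReal.ofReal_le_ofReal ?_
  rw [← Real.exp_log (show (0 : ℝ) < 5 by norm_num), ← Real.exp_add]
  refine Real.exp_le_exp.2 ?_
  rw [← hε]
  linarith
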